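/- All graphs are finite and simple; the order of a graph is its number of vertices and its size is its number of edges. A set $S$ of vertices of $G$ is a dissociation set if the induced subgraph $G[S]$ has maximum degree at most $1$; the dissociation number of $G$ is the largest cardinality of a dissociation set. Let $\mathcal{D}_{n,4}$ be the set of connected graphs of order $n$ with dissociation number $4$, and let $e_{\min}(\mathcal{D}_{n,4})$ be the minimum size of a graph in $\mathcal{D}_{n,4}$. Let $L_5 = C_4 \vee K_1$ be the join of the $4$-cycle (the complement of a perfect matching in $K_4$) and a single vertex. A graph is $L_5$-free if it does not contain $L_5$ as a (not necessarily induced) subgraph, and $\mathrm{ex}(n,L_5)$ is the maximum size of an $L_5$-free graph of order $n$. Let $G_{n,4}$ be the set of graphs obtained from a complete bipartite graph $K_{n_1,n_2}$ with $n_1+n_2=n$, $|n_1-n_2|\le 2$, and $|n_1-n_2|=2$ only if $n_1$ and $n_2$ are both even, by adding a maximum matching within each of the two parts. Let $G^-_{n,4}$ be the set of graphs obtained by deleting one edge from a graph in $G_{n,4}$. Let $\mathcal{T}_{n,4}$ be the set of connected graphs obtained by adding one new edge to a graph that has exactly two connected components and whose complement is in $G_{n,4}$. **Proposition.** Let $n\ge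 8$ and let $G$ be a graph of order $n$. Then: 1. $G\in\mathcal{D}_{n,4}$ and $G$ has size $e_{\min}(\mathcal{D}_{n,4})$ if and only if $G\in\mathcal{T}_{n,4}$. 2. $G$ is $L_5$-free of size $\mathrm{ex}(n,L_5)$ if and only if $G\in G_{n,4}$. 3. $G$ is $L_5$-free of size $\mathrm{ex}(n,L_5)-1$ if and only if $G\in G^-_{n,4}$. -/

import Mathlib

namespace DissociationGraphs

open SimpleGraph

/-- The size `e(G)` of a graph: its number of edges. -/
noncomputable def size {V : Type*} (G : SimpleGraph V) : ℕ := G.edgeSet.ncard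

/-- A set `S` of vertices is a dissociation set if every vertex of the induced graph `G[S]` has
degree at most `1`. -/
def IsDissociationSet {V : Type*} (G : SimpleGraph V) (S : Set V) : Prop :=
  ∀ v : S, ((G.induce S).neighborSet v).encard ≤ 1

/-- The dissociation number `τ(G)` of a finite graph: the largest size of a dissociation set. -/
noncomputable def dissociationNumber {V : Type*} [Fintype V] (G : SimpleGraph V) : ℕ :=
  sSup {m : ℕ | ∃ S : Finset V, IsDissociationSet G (S : Set V) ∧ S.card = m}

/-- The connected graphs on the vertex set `V` with dissociation number `τ`; for `|V| = n` this is
the class `𝓓_{n,τ}`. -/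
def connectedWithDissociationNumber (V : Type*) [Fintype V] (τ : ℕ) : Set (SimpleGraph V) :=
  {G | G.Connected ∧ dissociationNumber G = τ}

/-- The minimum size `e_min(𝓓_{n,τ})` of a connected graph of order `n` with dissociation
number `τ`. -/
noncomputable def eMin (n τ : ℕ) : ℕ :=
  sInf (size '' connectedWithDissociationNumber (Fin n) τ)

/-- The join `G ∨ H` of two graphs. -/
def join {V W : Type*} (G : SimpleGraph V) (H : SimpleGraph W) : SimpleGraph (V ⊕ W) :=
  (G ⊕g H) ⊔ completeBipartiteGraph V W

/-- The cocktail party graph `CP_{2k}`: the complement of the perfect matching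
`{(i, 0), (i, 1)}`, `i < k`, in the complete graph on `2k` vertices. -/
def cocktailParty (k : ℕ) : SimpleGraph (Fin k × Fin 2) :=
  (SimpleGraph.fromRel fun p q => p.1 = q.1)ᶜ

/-- The odd cocktail party graph `L_{2k+1} = CP_{2k} ∨ K_1`. -/
def oddCocktailParty (k : ℕ) : SimpleGraph ((Fin k × Fin 2) ⊕ Unit) :=
  join (cocktailParty k) (⊤ : SimpleGraph Unit)

/-- `M` is a maximum matching of the complete graph on the vertex set `S`. -/
def IsMaximumMatchingOn {V : Type*} (S : Set V) (M : (⊤ : SimpleGraph V).Subgraph) : Prop :=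
  M.IsMatching ∧ M.verts ⊆ S ∧
    ∀ N : (⊤ : SimpleGraph V).Subgraph, N.IsMatching → N.verts ⊆ S →
      N.edgeSet.ncard ≤ M.edgeSet.ncard

/-- The set `G_{n,2k}` of graphs (on an `n`-element vertex set `V`). The map `c` names the part of
each vertex, the parts have sizes `n_i` with `|n_i - n_j| ≤ 2`, where a difference of exactly `2`
is allowed only if `n_i` and `n_j` are both even, and a maximum matching `M i` is added within
each part of the complete `k`-partite graph with these parts. -/
def matchedPartite (V : Type*) [Fintype V] (k : ℕ) : Set (SimpleGraph V) :=
  {G | ∃ (c : V → Fin k) (M : Fin k → (⊤ : SimpleGraph V).Subgraph),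
    (∀ i j : Fin k,
      |((c ⁻¹' {i}).ncard : ℤ) - ((c ⁻¹' {j}).ncard : ℤ)| ≤ 2 ∧
      (|((c ⁻¹' {i}).ncard : ℤ) - ((c ⁻¹' {j}).ncard : ℤ)| = 2 →
        Even (c ⁻¹' {i}).ncard ∧ Even (c ⁻¹' {j}).ncard)) ∧
    (∀ i : Fin k, IsMaximumMatchingOn (c ⁻¹' {i}) (M i)) ∧
    G = (⊤ : SimpleGraph (Fin k)).comap c ⊔ ⨆ i : Fin k, (M i).spanningCoe}

/-- The set `G⁻_{n,2k}`: graphs obtained from a graph in `G_{n,2k}` by deleting an edge. -/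
def matchedPartiteMinus (V : Type*) [Fintype V] (k : ℕ) : Set (SimpleGraph V) :=
  {G | ∃ H ∈ matchedPartite V k, ∃ e ∈ H.edgeSet, G = H.deleteEdges {e}}

/-- The set `𝓣_{n,2k}`: connected graphs obtained by adding `k - 1` new edges to a graph `H` with
exactly `k` connected components whose complement lies in `G_{n,2k}`. -/
def treeLike (V : Type*) [Fintype V] (k : ℕ) : Set (SimpleGraph V) :=
  {G | ∃ H : SimpleGraph V, Hᶜ ∈ matchedPartite V k ∧ Nat.card H.ConnectedComponent = k ∧
    H ≤ G ∧ (G.edgeSet \ H.edgeSet).ncard = k - 1 ∧ G.Connected}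

end DissociationGraphs

/-! `L_5` is the wheel with four spokes. A set of five vertices is a dissociation set of `G` exactly
when these vertices carry a wheel in `Gᶜ`. So dissociation number at most `4` means that `Gᶜ` is
wheel-free, and small graphs `G` correspond to large wheel-free graphs.

Let `w(n) = wheelBound n`, which is `(n² + 2n) / 4` up to an error of at most `1`. A vertex outside
a four-clique of a wheel-free graph has at most two neighbours in it, so removing the clique removes
at most `6 + 2(n - 4)` edges, and this is the recursion of `w`. A graph without a four-clique loses
at least two edges against `w` once `n ≥ 8` (`WheelFree.adjCount_le`).

A wheel-free graph with at least `w(n) - 1` edges therefore contains a four-clique, and at most one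
edge is lost in the count. All outer vertices, with at most one exception, then see exactly two
clique vertices. Adjacent outer vertices must see equal or complementary pairs, and the outer graph
cannot split into parts without edges between them, so only one complementary pair of pairs occurs.
This gives a two-colouring in which every vertex has at most one neighbour of its own colour
(`WheelFree.exists_isNearColoring`). Extending the monochromatic matchings to maximum ones places
the graph inside a member of `G_{n,4}`, which has exactly `w(n)` edges. Statements 2 and 3 follow.

The complement of a graph in `G_{n,4}` has two components, so the complement of a connected graph
misses the bound `w(n)`. The best possible is one edge less, which by statement 3 gives the class
`𝓣_{n,4}`. -/

namespace DissociationGraphs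

open SimpleGraph Finset

/-! ### Doubled edge counts inside and between finite vertex sets -/

section Counting

open scoped Classical

variable {V : Type*} (G : SimpleGraph V)

/-- The number of ordered pairs of adjacent vertices in `s ×ˢ t`. -/
noncomputable def adjCount (s t : Finset V) : ℕ :=
  ∑ v ∈ s, #{w ∈ t | G.Adj v w}

variable {G}

theorem adjCount_comm (s t : Finset V) : adjCount G s t = adjCount G t s := by
  unfold adjCount
  have h := Finset.sum_card_bipartiteAbove_eq_sum_card_bipartiteBelow (s := s) (t := t) G.Adj
  simp only [bipartiteAbove, bipartiteBelow] at h
  rw [h]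
  simp only [G.adj_comm]

theorem adjCount_union_left {s s' : Finset V} (h : Disjoint s s') (t : Finset V) :
    adjCount G (s ∪ s') t = adjCount G s t + adjCount G s' t := by
  unfold adjCount
  rw [sum_union h]

theorem adjCount_union_right (s : Finset V) {t t' : Finset V} (h : Disjoint t t') :
    adjCount G s (t ∪ t') = adjCount G s t + adjCount G s t' := by
  rw [adjCount_comm, adjCount_union_left h, adjCount_comm t, adjCount_comm t']

theorem adjCount_union_self {s t : Finset V} (h : Disjoint s t) :
    adjCount G (s ∪ t) (s ∪ t) =
      adjCount G s s + adjCount G t t + 2 * adjCount G t s := by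
  rw [adjCount_union_left h, adjCount_union_right _ h, adjCount_union_right _ h,
    adjCount_comm s t]
  ring

theorem adjCount_sdiff_self {s t : Finset V} (h : t ⊆ s) :
    adjCount G s s =
      adjCount G t t + adjCount G (s \ t) (s \ t) + 2 * adjCount G (s \ t) t := by
  conv_lhs => rw [← union_sdiff_of_subset h]
  exact adjCount_union_self disjoint_sdiff

theorem adjCount_singleton (v : V) : adjCount G {v} {v} = 0 := by
  simp [adjCount, filter_singleton]

theorem adjCount_even (s : Finset V) : Even (adjCount G s s) := by
  induction s using Finset.induction_on with
  | empty => simp [adjCount]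
  | insert v s hv ih =>
    rw [insert_eq, adjCount_union_self (by simpa using hv), adjCount_singleton]
    rw [zero_add]
    exact ih.add (even_two_mul _)

theorem adjCount_le_mul {s t : Finset V} {k : ℕ}
    (h : ∀ v ∈ s, #{w ∈ t | G.Adj v w} ≤ k) : adjCount G s t ≤ #s * k := by
  unfold adjCount
  simpa using sum_le_card_nsmul s _ k h

theorem adjCount_self_le (s : Finset V) : adjCount G s s ≤ #s * (#s - 1) := by
  refine adjCount_le_mul fun v hv => ?_
  rw [← card_erase_of_mem hv]
  refine card_le_card fun w hw => ?_
  simp only [mem_filter, mem_erase] at hw ⊢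
  exact ⟨hw.2.ne', hw.1⟩

theorem two_mul_size [Fintype V] : 2 * size G = adjCount G univ univ := by
  have h := G.sum_degrees_eq_twice_card_edges
  unfold size adjCount
  rw [Set.ncard_eq_toFinset_card', ← edgeFinset, ← h]
  refine sum_congr rfl fun v _ => ?_
  rw [← card_neighborFinset_eq_degree, neighborFinset_eq_filter]

/-- If adjacent vertices of `s` have at most one common neighbour in `s`, then `s` spans at most
`#s * (#s + 1) / 4` edges. -/
theorem two_mul_adjCount_le_of_card_common_le_one {s : Finset V}
    (h : ∀ u ∈ s, ∀ v ∈ s, G.Adj u v → #{w ∈ s | G.Adj u w ∧ G.Adj v w} ≤ 1) :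
    2 * adjCount G s s ≤ #s * (#s + 1) := by
  set d : V → ℕ := fun v => #{w ∈ s | G.Adj v w} with hd
  have h1 : ∀ u ∈ s, ∀ v ∈ s, G.Adj u v → d u + d v ≤ #s + 1 := by
    intro u hu v hv huv
    have h2 := card_union_add_card_inter ({w ∈ s | G.Adj u w}) ({w ∈ s | G.Adj v w})
    rw [← filter_and, ← filter_or] at h2
    have h3 := h u hu v hv huv
    have h4 : #{w ∈ s | G.Adj u w ∨ G.Adj v w} ≤ #s := card_filter_le _ _
    simp only [hd]
    omega
  -- Summing `d u + d v` over ordered adjacent pairs gives twice the sum of the squared degrees.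
  -- Cauchy–Schwarz then bounds the sum of the degrees.
  have hswap : ∑ u ∈ s, ∑ v ∈ s with G.Adj u v, d v = ∑ u ∈ s, d u * d u := by
    simp only [sum_filter]
    rw [sum_comm]
    refine sum_congr rfl fun v _ => ?_
    rw [← sum_filter, sum_const, smul_eq_mul]
    simp only [hd, G.adj_comm]
  have hsame : ∑ u ∈ s, ∑ v ∈ s with G.Adj u v, d u = ∑ u ∈ s, d u * d u := by
    refine sum_congr rfl fun u _ => ?_
    rw [sum_const, smul_eq_mul]
  have hsum : ∑ u ∈ s, ∑ v ∈ s with G.Adj u v, (d u + d v) ≤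
      ∑ u ∈ s, ∑ v ∈ s with G.Adj u v, (#s + 1) := by
    refine sum_le_sum fun u hu => sum_le_sum fun v hv => ?_
    rw [mem_filter] at hv
    exact h1 u hu v hv.1 hv.2
  have hleft : ∑ u ∈ s, ∑ v ∈ s with G.Adj u v, (d u + d v) = 2 * ∑ u ∈ s, d u ^ 2 := by
    simp only [sum_add_distrib]
    rw [hswap, hsame, ← two_mul]
    simp only [pow_two]
  have hright : ∑ u ∈ s, ∑ v ∈ s with G.Adj u v, (#s + 1) = (∑ u ∈ s, d u) * (#s + 1) := by
    rw [sum_mul]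
    exact sum_congr rfl fun u _ => by rw [sum_const, smul_eq_mul]
  rw [hleft, hright] at hsum
  have hD : adjCount G s s = ∑ u ∈ s, d u := rfl
  have hcs : (∑ u ∈ s, d u) ^ 2 ≤ #s * ∑ u ∈ s, d u ^ 2 := sq_sum_le_card_mul_sum_sq
  rw [hD]
  clear_value d
  rcases Nat.eq_zero_or_pos (∑ u ∈ s, d u) with h0 | h0
  · rw [h0]; simp
  · refine le_of_mul_le_mul_left (a := ∑ u ∈ s, d u) ?_ h0
    have := Nat.mul_le_mul_left (#s) hsum
    nlinarith

end Counting

/-! ### The function `wheelBound` -/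

section Arithmetic

/-- The extremal number of the wheel `L_5`. -/
def wheelBound (n : ℕ) : ℕ :=
  4 * (n / 4) ^ 2 + 2 * (n / 4) + 2 * (n / 4) * (n % 4) + (n % 4) * (n % 4 - 1) / 2

/-- The increment is the largest contribution of a four-clique: six edges inside, and two edges to
each of the other `n` vertices. -/
theorem wheelBound_add_four (n : ℕ) : wheelBound (n + 4) = wheelBound n + 2 * n + 6 := by
  unfold wheelBound
  have h1 : (n + 4) / 4 = n / 4 + 1 := by omega
  have h2 : (n + 4) % 4 = n % 4 := by omega
  rw [h1, h2]
  have h3 : n = 4 * (n / 4) + n % 4 := by omega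
  generalize n % 4 * (n % 4 - 1) / 2 = t
  nlinarith

theorem four_mul_wheelBound (n : ℕ) :
    4 * wheelBound n ≤ n ^ 2 + 2 * n ∧ n ^ 2 + 2 * n ≤ 4 * wheelBound n + 4 := by
  induction n using Nat.strong_induction_on with
  | _ n ih =>
    rcases lt_or_ge n 4 with h | h
    · interval_cases n <;> simp [wheelBound]
    · obtain ⟨m, rfl⟩ := Nat.exists_eq_add_of_le' h
      have := ih m (by omega)
      rw [wheelBound_add_four]
      constructor <;> nlinarith

/-- Superadditivity with a gap of at least two: a vertex set spanning at most one edge less than the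
bound cannot split into two parts without edges between them. -/
theorem wheelBound_add_lt {p q : ℕ} (hp : 1 ≤ p) (hq : 1 ≤ q) (h : 4 ≤ p + q) :
    wheelBound p + wheelBound q + 1 < wheelBound (p + q) := by
  rcases le_or_gt (p * q) 4 with h4 | h4
  · have : p ≤ 4 := by nlinarith
    have : q ≤ 4 := by nlinarith
    interval_cases p <;> interval_cases q <;> first | omega | simp [wheelBound]
  · have h1 := four_mul_wheelBound p
    have h2 := four_mul_wheelBound q
    have h3 := four_mul_wheelBound (p + q)
    nlinarith

/-- The analogue for two parts that overlap in a single vertex, namely the exceptional one. -/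
theorem wheelBound_succ_add_lt {p q : ℕ} (hp : 1 ≤ p) (hq : 1 ≤ q) (h : 3 ≤ p + q) :
    wheelBound (p + 1) + wheelBound (q + 1) < wheelBound (p + q + 1) := by
  rcases le_or_gt (p * q) 3 with h4 | h4
  · have : p ≤ 3 := by nlinarith
    have : q ≤ 3 := by nlinarith
    interval_cases p <;> interval_cases q <;> first | omega | simp [wheelBound]
  · have h1 := four_mul_wheelBound (p + 1)
    have h2 := four_mul_wheelBound (q + 1)
    have h3 := four_mul_wheelBound (p + q + 1)
    nlinarith

/-- If `K_{p,q}` with maximum matchings added to both parts has almost as many edges as possible,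
then its parts are balanced. -/
theorem balanced_of_wheelBound_le {p q : ℕ}
    (h : wheelBound (p + q) ≤ p * q + p / 2 + q / 2 + 1) :
    |(p : ℤ) - q| ≤ 2 ∧ (|(p : ℤ) - q| = 2 → Even p ∧ Even q) := by
  have h1 := (four_mul_wheelBound (p + q)).2
  -- The hypothesis and the lower bound on `wheelBound` give `(p - q)² ≤ 8`.
  have hsq : ((p : ℤ) - q) ^ 2 < 3 ^ 2 := by
    have e1 : 2 * (p / 2) ≤ p := by omega
    have e2 : 2 * (q / 2) ≤ q := by omega
    zify at *
    nlinarith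
  have habs := abs_lt_of_sq_lt_sq hsq (by norm_num)
  rw [abs_lt] at habs
  refine ⟨abs_le.2 (by omega), fun h2 => ?_⟩
  by_contra hodd
  wlog hpq : p ≤ q generalizing p q
  · refine this (by rw [add_comm q p, mul_comm q p]; omega) (by rwa [add_comm q p]) ?_ ?_
      (by rwa [abs_sub_comm]) (by tauto) (by omega)
    · rw [← neg_sub, neg_sq]; exact hsq
    · omega
  have hq : q = p + 2 := by
    rw [abs_sub_comm, abs_of_nonneg (by omega)] at h2
    omega
  subst hq
  have hp : Odd p := by
    rw [← Nat.not_even_iff_odd]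
    intro he
    exact hodd ⟨he, he.add even_two⟩
  -- Odd parts of sizes `2k + 1` and `2k + 3` each leave a vertex unmatched. The count is then `4k²
  -- + 10k + 4`, two below the bound, while a loss of only one is allowed.
  obtain ⟨k, rfl⟩ := hp
  have e0 : 2 * k + 1 + (2 * k + 1 + 2) = 4 * (k + 1) := by ring
  have e1 : (2 * k + 1) / 2 = k := by omega
  have e2 : (2 * k + 1 + 2) / 2 = k + 1 := by omega
  rw [e0, e1, e2] at h
  have e3 : 4 * (k + 1) / 4 = k + 1 := by omega
  have e4 : 4 * (k + 1) % 4 = 0 := by omega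
  unfold wheelBound at h
  rw [e3, e4] at h
  norm_num at h
  nlinarith

/-- The difference of the parts and the parity of the smaller one determine the residue of `p + q`
modulo `4`, and on each residue class both sides are polynomials in `k`. -/
theorem wheelBound_eq_of_balanced {p q : ℕ}
    (h : |(p : ℤ) - q| ≤ 2 ∧ (|(p : ℤ) - q| = 2 → Even p ∧ Even q)) :
    p * q + p / 2 + q / 2 = wheelBound (p + q) := by
  wlog hpq : p ≤ q generalizing p q
  · rw [add_comm p q, ← this (by rw [abs_sub_comm]; tauto) (by omega), mul_comm q p]
    omega
  obtain ⟨d, rfl⟩ := Nat.exists_eq_add_of_le hpq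
  obtain ⟨h1, h2⟩ := h
  have e : ((p : ℤ) - (p + d : ℕ)) = -d := by push_cast; ring
  rw [e, abs_neg, Nat.abs_cast] at h1 h2
  have hd : d ≤ 2 := by omega
  have key : ∀ k, (∀ n, n = 4 * k → wheelBound n = 4 * k ^ 2 + 2 * k) ∧
      (∀ n, n = 4 * k + 1 → wheelBound n = 4 * k ^ 2 + 4 * k) ∧
      (∀ n, n = 4 * k + 2 → wheelBound n = 4 * k ^ 2 + 6 * k + 1) ∧
      (∀ n, n = 4 * k + 3 → wheelBound n = 4 * k ^ 2 + 8 * k + 3) := by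
    intro k
    refine ⟨?_, ?_, ?_, ?_⟩ <;> rintro n rfl <;> unfold wheelBound
    · rw [show 4 * k / 4 = k by omega, show 4 * k % 4 = 0 by omega]; norm_num
    · rw [show (4 * k + 1) / 4 = k by omega, show (4 * k + 1) % 4 = 1 by omega]; norm_num; ring
    · rw [show (4 * k + 2) / 4 = k by omega, show (4 * k + 2) % 4 = 2 by omega]; norm_num; ring
    · rw [show (4 * k + 3) / 4 = k by omega, show (4 * k + 3) % 4 = 3 by omega]; norm_num; ring
  obtain ⟨k, hk⟩ : ∃ k, p = 2 * k ∨ p = 2 * k + 1 := ⟨p / 2, by omega⟩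
  interval_cases d <;> rcases hk with rfl | rfl
  · rw [(key k).1 _ (by ring), show (2 * k + 0) / 2 = k by omega, show 2 * k / 2 = k by omega]
    ring
  · rw [(key k).2.2.1 _ (by ring), add_zero, show (2 * k + 1) / 2 = k by omega]
    ring
  · rw [(key k).2.1 _ (by ring), show (2 * k + 1) / 2 = k by omega, show 2 * k / 2 = k by omega]
    ring
  · rw [(key k).2.2.2 _ (by ring), show (2 * k + 1 + 1) / 2 = k + 1 by omega,
      show (2 * k + 1) / 2 = k by omega]
    ring
  · rw [(key k).2.2.1 _ (by ring), show (2 * k + 2) / 2 = k + 1 by omega,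
      show 2 * k / 2 = k by omega]
    ring
  · exact absurd (h2 rfl).1 (by simp)

end Arithmetic

/-! ### The extremal bound for wheel-free graphs -/

section Wheel

open scoped Classical

variable {V : Type*} {G : SimpleGraph V}

/-- No vertex is adjacent to all vertices of a `4`-cycle. -/
def WheelFree (G : SimpleGraph V) : Prop :=
  ∀ ⦃v a b c d : V⦄, G.Adj v a → G.Adj v b → G.Adj v c → G.Adj v d →
    G.Adj a b → G.Adj b c → G.Adj c d → G.Adj d a → a ≠ c → b ≠ d → False

/-- The vertices `a, b, c, d` are pairwise adjacent, except possibly `c` and `d`, which are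
distinct. -/
structure IsDiamond (G : SimpleGraph V) (a b c d : V) : Prop where
  ab : G.Adj a b
  ac : G.Adj a c
  ad : G.Adj a d
  bc : G.Adj b c
  bd : G.Adj b d
  ne : c ≠ d

/-- The vertices `a, b, c, d` are pairwise adjacent. -/
structure IsFourClique (G : SimpleGraph V) (a b c d : V) : Prop extends IsDiamond G a b c d where
  cd : G.Adj c d

theorem IsFourClique.of_adj {a b c d : V} (ab : G.Adj a b) (ac : G.Adj a c) (ad : G.Adj a d)
    (bc : G.Adj b c) (bd : G.Adj b d) (cd : G.Adj c d) : IsFourClique G a b c d :=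
  ⟨⟨ab, ac, ad, bc, bd, cd.ne⟩, cd⟩

/-- The number of neighbours of `x` among four vertices. -/
noncomputable def degFour (G : SimpleGraph V) (a b c d x : V) : ℕ :=
  (if G.Adj x a then 1 else 0) + (if G.Adj x b then 1 else 0) +
    (if G.Adj x c then 1 else 0) + (if G.Adj x d then 1 else 0)

namespace IsDiamond

variable {a b c d : V}

theorem card_filter_adj (h : IsDiamond G a b c d) (x : V) :
    #{w ∈ ({a, b, c, d} : Finset V) | G.Adj x w} = degFour G a b c d x := by
  have h1 := h.ab.ne
  have h2 := h.ac.ne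
  have h3 := h.ad.ne
  have h4 := h.bc.ne
  have h5 := h.bd.ne
  have h6 := h.ne
  rw [card_filter, sum_insert (by simp [*]), sum_insert (by simp [*]), sum_insert (by simp [*]),
    sum_singleton]
  unfold degFour
  ring

theorem card_eq (h : IsDiamond G a b c d) : #({a, b, c, d} : Finset V) = 4 := by
  have h1 := h.ab.ne
  have h2 := h.ac.ne
  have h3 := h.ad.ne
  have h4 := h.bc.ne
  have h5 := h.bd.ne
  have h6 := h.ne
  rw [card_insert_of_notMem (by simp [*]), card_insert_of_notMem (by simp [*]),
    card_insert_of_notMem (by simp [*]), card_singleton]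

/-- Neighbours `c`, `d` and one of `a`, `b` already make a wheel with that one as hub. The triples
`a, b, c` and `a, b, d` only produce a four-clique, so they are excluded by hypothesis. -/
theorem degFour_le_two (h : IsDiamond G a b c d) (hW : WheelFree G) {x : V}
    (hxa : x ≠ a) (hxb : x ≠ b)
    (h1 : G.Adj x a → G.Adj x b → G.Adj x c → False)
    (h2 : G.Adj x a → G.Adj x b → G.Adj x d → False) : degFour G a b c d x ≤ 2 := by
  have h3 : G.Adj x a → G.Adj x c → G.Adj x d → False := fun xa xc xd =>
    hW h.ac xa.symm h.ad h.ab xc.symm xd h.bd.symm h.bc h.ne hxb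
  have h4 : G.Adj x b → G.Adj x c → G.Adj x d → False := fun xb xc xd =>
    hW h.bc xb.symm h.bd h.ab.symm xc.symm xd h.ad.symm h.ac h.ne hxa
  unfold degFour
  split_ifs <;> first | omega | tauto

theorem adjCount_self_le (h : IsDiamond G a b c d) (hcd : ¬ G.Adj c d) :
    adjCount G {a, b, c, d} {a, b, c, d} ≤ 10 := by
  have h1 := h.ab.ne
  have h2 := h.ac.ne
  have h3 := h.ad.ne
  have h4 := h.bc.ne
  have h5 := h.bd.ne
  have h6 := h.ne
  have h7 : ¬ G.Adj d c := fun h => hcd h.symm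
  have hdeg := h.card_filter_adj
  unfold adjCount
  rw [sum_insert (by simp [*]), sum_insert (by simp [*]), sum_insert (by simp [*]),
    sum_singleton]
  simp only [hdeg, degFour, hcd, h7, SimpleGraph.irrefl, if_false, h.ab, h.ac, h.ad, h.bc, h.bd,
    h.ab.symm, h.ac.symm, h.ad.symm, h.bc.symm, h.bd.symm, if_true]
  omega

end IsDiamond

theorem IsFourClique.degFour_le_two {a b c d x : V} (h : IsFourClique G a b c d)
    (hW : WheelFree G) (hxa : x ≠ a) (hxb : x ≠ b) (hxc : x ≠ c) (hxd : x ≠ d) :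
    degFour G a b c d x ≤ 2 :=
  h.toIsDiamond.degFour_le_two hW hxa hxb
    (fun xa xb xc => hW h.ab xa.symm h.ac h.ad xb.symm xc h.cd h.bd.symm h.bc.ne hxd)
    (fun xa xb xd => hW h.ab xa.symm h.ad h.ac xb.symm xd h.cd.symm h.bc.symm h.bd.ne hxc)

theorem adjCount_le_of_remove {s S : Finset V} (hS : S ⊆ s)
    (h : ∀ x ∈ s \ S, #{w ∈ S | G.Adj x w} ≤ 2) :
    adjCount G s s ≤ adjCount G S S + adjCount G (s \ S) (s \ S) + 4 * #(s \ S) := by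
  rw [adjCount_sdiff_self hS]
  have := adjCount_le_mul h
  omega

/-- Induction by removing four vertices. A four-clique contributes at most what the recursion of
`wheelBound` allows. Without four-cliques, a diamond has only five edges, so each removed diamond
costs one edge, and two such losses are available from eight vertices on. Without diamonds, adjacent
vertices have at most one common neighbour and the set is much sparser. -/
theorem WheelFree.adjCount_le (hW : WheelFree G) (s : Finset V) :
    adjCount G s s ≤ 2 * wheelBound #s ∧
      ((∀ a ∈ s, ∀ b ∈ s, ∀ c ∈ s, ∀ d ∈ s, ¬ IsFourClique G a b c d) →
        (4 ≤ #s → adjCount G s s + 2 ≤ 2 * wheelBound #s) ∧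
        (8 ≤ #s → adjCount G s s + 4 ≤ 2 * wheelBound #s)) := by
  induction s using Finset.strongInduction with
  | _ s ih =>
  have hfree : (∀ a ∈ s, ∀ b ∈ s, ∀ c ∈ s, ∀ d ∈ s, ¬ IsFourClique G a b c d) →
        (#s < 4 → adjCount G s s ≤ 2 * wheelBound #s) ∧
        (4 ≤ #s → adjCount G s s + 2 ≤ 2 * wheelBound #s) ∧
        (8 ≤ #s → adjCount G s s + 4 ≤ 2 * wheelBound #s) := by
    intro hK
    by_cases hD : ∃ a ∈ s, ∃ b ∈ s, ∃ c ∈ s, ∃ d ∈ s, IsDiamond G a b c d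
    · obtain ⟨a, ha, b, hb, c, hc, d, hd, h⟩ := hD
      have hS : ({a, b, c, d} : Finset V) ⊆ s := by
        intro x hx
        simp only [mem_insert, mem_singleton] at hx
        rcases hx with rfl | rfl | rfl | rfl <;> assumption
      have hcd : ¬ G.Adj c d := fun hcd => hK a ha b hb c hc d hd ⟨h, hcd⟩
      have h1 := h.adjCount_self_le hcd
      have h2 := adjCount_le_of_remove hS (fun x hx => by
        rw [h.card_filter_adj]
        simp only [mem_sdiff, mem_insert, mem_singleton, not_or] at hx
        obtain ⟨hxs, hxa, hxb, -, -⟩ := hx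
        exact h.degFour_le_two hW hxa hxb
          (fun xa xb xc => hK x hxs a ha b hb c hc (.of_adj xa xb xc h.ab h.ac h.bc))
          (fun xa xb xd => hK x hxs a ha b hb d hd (.of_adj xa xb xd h.ab h.ad h.bd)))
      obtain ⟨h3, h4⟩ := ih (s \ {a, b, c, d})
        (sdiff_ssubset hS ⟨a, by simp⟩)
      have h5 := (h4 fun a ha b hb c hc d hd => hK a (mem_sdiff.1 ha).1 b (mem_sdiff.1 hb).1
        c (mem_sdiff.1 hc).1 d (mem_sdiff.1 hd).1).1
      have h6 := card_sdiff_add_card_eq_card hS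
      rw [h.card_eq] at h6
      rw [← h6, wheelBound_add_four]
      omega
    · push Not at hD
      have h1 := two_mul_adjCount_le_of_card_common_le_one (G := G) (s := s) (by
        intro u hu v hv huv
        rw [card_le_one]
        intro c hc d hd
        rw [mem_filter] at hc hd
        by_contra hne
        exact hD u hu v hv c hc.1 d hd.1 ⟨huv, hc.2.1, hd.2.1, hc.2.2, hd.2.2, hne⟩)
      have h2 := adjCount_self_le (G := G) s
      have h3 := (four_mul_wheelBound #s).2
      have h4 := adjCount_even (G := G) s
      generalize adjCount G s s = D at *
      generalize #s = n at *
      obtain ⟨k, rfl⟩ := h4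
      -- From `2D ≤ n² + n` and `n² + 2n ≤ 4 * wheelBound n + 4` the claim follows once `n ≥ 12`.
      -- Below this, evenness of `D` matters: for `n = 5` the estimate allows `15`, but `14` is
      -- required.
      rcases lt_or_ge n 12 with hn | hn
      · interval_cases n <;> simp [wheelBound] <;> omega
      · refine ⟨by omega, fun _ => ?_, fun _ => ?_⟩ <;> nlinarith
  by_cases hK : ∀ a ∈ s, ∀ b ∈ s, ∀ c ∈ s, ∀ d ∈ s, ¬ IsFourClique G a b c d
  · have := hfree hK
    refine ⟨?_, fun _ => this.2⟩
    omega
  · refine ⟨?_, fun h => absurd h hK⟩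
    push Not at hK
    obtain ⟨a, ha, b, hb, c, hc, d, hd, h⟩ := hK
    have hS : ({a, b, c, d} : Finset V) ⊆ s := by
      intro x hx
      simp only [mem_insert, mem_singleton] at hx
      rcases hx with rfl | rfl | rfl | rfl <;> assumption
    have h1 := DissociationGraphs.adjCount_self_le (G := G) {a, b, c, d}
    rw [h.card_eq] at h1
    have h2 := adjCount_le_of_remove hS (fun x hx => by
      rw [h.card_filter_adj]
      simp only [mem_sdiff, mem_insert, mem_singleton, not_or] at hx
      obtain ⟨-, hxa, hxb, hxc, hxd⟩ := hx
      exact h.degFour_le_two hW hxa hxb hxc hxd)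
    have h3 := (ih (s \ {a, b, c, d}) (sdiff_ssubset hS ⟨a, by simp⟩)).1
    have h6 := card_sdiff_add_card_eq_card hS
    rw [h.card_eq] at h6
    rw [← h6, wheelBound_add_four]
    omega

end Wheel

/-! ### Near colourings and the neighbourhoods of a four-clique -/

section Structure

open scoped Classical

variable {V : Type*} {G : SimpleGraph V}

/-- Every vertex has at most one neighbour of its own colour. -/
def IsNearColoring {α : Type*} (G : SimpleGraph V) (C : V → α) : Prop :=
  ∀ ⦃v x y : V⦄, G.Adj v x → G.Adj v y → C x = C v → C y = C v → x = y

/-- At most one rim vertex has the colour of the hub. Three consecutive rim vertices then share the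
other colour, and the middle one has two neighbours of its own colour. -/
theorem IsNearColoring.wheelFree {C : V → Fin 2} (h : IsNearColoring G C) : WheelFree G := by
  intro v a b c d va vb vc vd ab bc cd da hac hbd
  have key : ∀ i j k : Fin 2, i ≠ k → j ≠ k → i = j := by omega
  have kab := key (C a) (C b) (C v)
  have kbc := key (C b) (C c) (C v)
  have kcd := key (C c) (C d) (C v)
  have kda := key (C d) (C a) (C v)
  have h1 := h va vb
  have h2 := h va vc
  have h3 := h va vd
  have h4 := h vb vc
  have h5 := h vb vd
  have h6 := h vc vd
  have h7 := h ab da.symm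
  have h8 := h ab.symm bc
  have h9 := h bc.symm cd
  have h10 := h cd.symm da
  have e1 := ab.ne
  have e2 := bc.ne
  have e3 := cd.ne
  have e4 := da.ne
  clear h va vb vc vd ab bc cd da key
  by_cases ia : C a = C v <;> by_cases ib : C b = C v <;> by_cases ic : C c = C v <;>
    by_cases id : C d = C v <;> grind

/-- A four-clique `a, b, c, d` and a partition of the other vertices into `P` and `Q`, vertices in
`P` being nonadjacent to `c, d` and vertices in `Q` being adjacent to exactly `c, d`, give a
near colouring if there are no paths of length `2` in `P` and in `Q`. -/
theorem exists_isNearColoring_of_classes {a b c d : V} {P Q : V → Prop}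
    (hall : ∀ x, x = a ∨ x = b ∨ x = c ∨ x = d ∨ P x ∨ Q x)
    (hPc : ∀ x, P x → ¬ G.Adj x c) (hPd : ∀ x, P x → ¬ G.Adj x d)
    (hPa : ∀ x, P x → G.Adj x a)
    (hQa : ∀ x, Q x → ¬ G.Adj x a) (hQb : ∀ x, Q x → ¬ G.Adj x b)
    (hab : G.Adj a b) (hac : a ≠ c) (had : a ≠ d) (hbc : b ≠ c) (hbd : b ≠ d)
    (hP : ∀ v x y, P v → P x → P y → G.Adj v x → G.Adj v y → x = y)
    (hQ : ∀ v x y, Q v → Q x → Q y → G.Adj v x → G.Adj v y → x = y) :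
    ∃ C : V → Fin 2, IsNearColoring G C := by
  have hPQ : ∀ x, P x → ¬ Q x := fun x hx hq => hQa x hq (hPa x hx)
  have iff_of : ∀ (p q : Prop) [Decidable p] [Decidable q], ((if p then (0 : Fin 2) else 1) = if q then 0 else 1) →
      (p ↔ q) := by
    intro p q _ _ h
    by_cases h1 : p <;> by_cases h2 : q <;> simp_all
  -- Each class joins the clique vertices it is not adjacent to: `P` goes with `c, d`, and `Q` goes
  -- with `a, b`.
  set A : V → Prop := fun x => x = c ∨ x = d ∨ (P x ∧ x ≠ a ∧ x ≠ b) with hA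
  refine ⟨fun x => if A x then 0 else 1, fun v x y vx vy ex ey => ?_⟩
  beta_reduce at ex ey
  -- The only monochromatic edges are `ab`, `cd` and edges inside `P` or inside `Q`.
  have nbr : ∀ v x, G.Adj v x → (A x ↔ A v) → (v = a ∧ x = b) ∨ (v = b ∧ x = a) ∨
      (v = c ∧ x = d) ∨ (v = d ∧ x = c) ∨ (P v ∧ P x ∧ A v ∧ A x) ∨
        (Q v ∧ Q x ∧ ¬ A v ∧ ¬ A x) := by
    intro v x vx hvx
    have := vx.ne
    have xv := vx.symm
    simp only [hA] at *
    rcases hall v with rfl | rfl | rfl | rfl | h | h <;>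
      rcases hall x with rfl | rfl | rfl | rfl | h' | h' <;> grind
  have h1 := nbr v x vx (iff_of (A x) (A v) ex)
  have h2 := nbr v y vy (iff_of (A y) (A v) ey)
  have h3 := hP v x y
  have h4 := hQ v x y
  grind

theorem degFour_eq_two {a b c d x : V} (h : degFour G a b c d x = 2) :
    (G.Adj x a ∧ G.Adj x b ∧ ¬ G.Adj x c ∧ ¬ G.Adj x d) ∨
    (G.Adj x a ∧ ¬ G.Adj x b ∧ G.Adj x c ∧ ¬ G.Adj x d) ∨
    (G.Adj x a ∧ ¬ G.Adj x b ∧ ¬ G.Adj x c ∧ G.Adj x d) ∨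
    (¬ G.Adj x a ∧ G.Adj x b ∧ G.Adj x c ∧ ¬ G.Adj x d) ∨
    (¬ G.Adj x a ∧ G.Adj x b ∧ ¬ G.Adj x c ∧ G.Adj x d) ∨
    (¬ G.Adj x a ∧ ¬ G.Adj x b ∧ G.Adj x c ∧ G.Adj x d) := by
  unfold degFour at h
  split_ifs at h <;> first | omega | simp only [*, not_true_eq_false, not_false_eq_true, and_self,
    and_false, false_and, or_false, or_true]

theorem degFour_eq_one {a b c d x : V} (h : degFour G a b c d x = 1) :
    (G.Adj x a ∧ ¬ G.Adj x b ∧ ¬ G.Adj x c ∧ ¬ G.Adj x d) ∨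
    (¬ G.Adj x a ∧ G.Adj x b ∧ ¬ G.Adj x c ∧ ¬ G.Adj x d) ∨
    (¬ G.Adj x a ∧ ¬ G.Adj x b ∧ G.Adj x c ∧ ¬ G.Adj x d) ∨
    (¬ G.Adj x a ∧ ¬ G.Adj x b ∧ ¬ G.Adj x c ∧ G.Adj x d) := by
  unfold degFour at h
  split_ifs at h <;> first | omega | simp only [*, not_true_eq_false, not_false_eq_true, and_self,
    and_false, false_and, or_false, or_true]

/-- Vertices joined by an edge have the same or complementary neighbourhoods in a four-clique. -/
theorem pairing_of_adj (hW : WheelFree G) {a b c d x y : V} (h : IsFourClique G a b c d)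
    (hxy : G.Adj x y)
    (hx : degFour G a b c d x = 2) (hy : degFour G a b c d y = 2)
    (hxb : x ≠ a ∧ x ≠ b ∧ x ≠ c ∧ x ≠ d) (hyb : y ≠ a ∧ y ≠ b ∧ y ≠ c ∧ y ≠ d)
    (hab : G.Adj x a ↔ G.Adj x b) : (G.Adj y a ↔ G.Adj y b) := by
  -- The wheel has hub `p` and rim `q, x, y, r`: the pairs seen by `x` and `y` cannot share exactly
  -- one vertex.
  have key : ∀ p q r, G.Adj p q → G.Adj p r → G.Adj q r → G.Adj x p → G.Adj x q →
      G.Adj y p → G.Adj y r → q ≠ y → x ≠ r → False :=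
    fun p q r pq pr qr xp xq yp yr h1 h2 =>
      hW pq xp.symm yp.symm pr xq.symm hxy yr qr.symm h1 h2
  obtain ⟨x1, x2, x3, x4⟩ := hxb
  obtain ⟨y1, y2, y3, y4⟩ := hyb
  have k1 := fun h1 h2 h3 h4 => key a b c h.ab h.ac h.bc h1 h2 h3 h4 y2.symm x3
  have k2 := fun h1 h2 h3 h4 => key a b d h.ab h.ad h.bd h1 h2 h3 h4 y2.symm x4
  have k3 := fun h1 h2 h3 h4 => key b a c h.ab.symm h.bc h.ac h1 h2 h3 h4 y1.symm x3
  have k4 := fun h1 h2 h3 h4 => key b a d h.ab.symm h.bd h.ad h1 h2 h3 h4 y1.symm x4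
  have k5 := fun h1 h2 h3 h4 => key c d a h.cd h.ac.symm h.ad.symm h1 h2 h3 h4 y4.symm x1
  have k6 := fun h1 h2 h3 h4 => key c d b h.cd h.bc.symm h.bd.symm h1 h2 h3 h4 y4.symm x2
  have k7 := fun h1 h2 h3 h4 => key d c a h.cd.symm h.ad.symm h.ac.symm h1 h2 h3 h4 y3.symm x1
  have k8 := fun h1 h2 h3 h4 => key d c b h.cd.symm h.bd.symm h.bc.symm h1 h2 h3 h4 y3.symm x2
  clear hW key h
  have hx' := degFour_eq_two hx
  have hy' := degFour_eq_two hy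
  grind

/-- In a set `R` spanning as many edges as a wheel-free graph can, let `w ∈ R` be adjacent to `a`
while `R \ {w}` is partitioned into `X` and `Y`, the vertices of `X` being adjacent to `a`, such
that neither `X` nor `Y` nor the neighbourhood of `w` in `X` contains a path of length two.
Then no vertex of `X` has neighbours `w` and `y ∈ X`. -/
theorem not_adj_of_extremal (hW : WheelFree G) {X Y : Finset V} {a w : V}
    (hwX : w ∉ X) (hwY : w ∉ Y) (hXY : Disjoint X Y)
    (hwa : G.Adj w a) (hXa : ∀ x ∈ X, G.Adj x a) (hYa : ∀ y ∈ Y, y ≠ a)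
    (hX : ∀ v ∈ X, ∀ x ∈ X, ∀ y ∈ X, G.Adj v x → G.Adj v y → x = y)
    (hXw : ∀ x ∈ X, ∀ y ∈ X, G.Adj w x → G.Adj w y → x = y)
    (hY : ∀ v ∈ Y, ∀ x ∈ Y, ∀ y ∈ Y, G.Adj v x → G.Adj v y → x = y)
    (hcard : 4 ≤ #X + 1 + #Y)
    (hext : 2 * wheelBound (#X + 1 + #Y) ≤ adjCount G (insert w X ∪ Y) (insert w X ∪ Y))
    {v y : V} (hv : v ∈ X) (hy : y ∈ X) (hvw : G.Adj v w) (hvy : G.Adj v y) : False := by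
  have hwv : w ≠ v := hvw.ne'
  have hwy : w ≠ y := fun h => hwX (h ▸ hy)
  have hdisj : Disjoint (insert w X) Y := by
    rw [disjoint_insert_left]
    exact ⟨hwY, hXY⟩
  have hX' : #(insert w X) = #X + 1 := card_insert_of_notMem hwX
  have hYY : adjCount G Y Y ≤ #Y * 1 := adjCount_le_mul fun z hz => by
    rw [card_le_one]
    intro x hx y hy
    rw [mem_filter] at hx hy
    exact hY z hz x hx.1 y hy.1 hx.2 hy.2
  -- A vertex `z` of `Y` adjacent to all of `w, v, y` would complete the rim `y, a, w, z` around the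
  -- hub `v`. So each vertex of `Y` misses a vertex of `insert w X`.
  have hYX : adjCount G Y (insert w X) ≤ #Y * #X := adjCount_le_mul fun z hz => by
    rw [← Nat.lt_add_one_iff, ← hX']
    refine card_lt_card ((filter_ssubset).2 ?_)
    by_contra hcon
    push Not at hcon
    have zw := hcon w (mem_insert_self _ _)
    have zv := hcon v (mem_insert_of_mem hv)
    have zy := hcon y (mem_insert_of_mem hy)
    exact hW hvy (hXa v hv) hvw zv.symm (hXa y hy) hwa.symm zw.symm zy hwy.symm (hYa z hz).symm
  -- Only `v` can have two neighbours here, since `v` is the unique neighbour of `w` in `X`.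
  have hXX : adjCount G (insert w X) (insert w X) ≤ #X + 2 := by
    have hmem : v ∈ insert w X := mem_insert_of_mem hv
    unfold adjCount
    rw [← add_sum_erase _ _ hmem]
    have h1 : #{u ∈ insert w X | G.Adj v u} ≤ 2 := by
      refine (card_le_card (t := {w, y}) fun u hu => ?_).trans card_le_two
      rw [mem_filter, mem_insert] at hu
      rw [mem_insert, mem_singleton]
      exact hu.1.imp id fun h => hX v hv u h y hy hu.2 hvy
    have h2 : ∑ x ∈ (insert w X).erase v, #{u ∈ insert w X | G.Adj x u} ≤
        #((insert w X).erase v) • 1 := by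
      refine sum_le_card_nsmul _ _ _ fun x hx => ?_
      rw [card_le_one]
      intro p hp q hq
      rw [mem_erase, mem_insert] at hx
      rw [mem_filter, mem_insert] at hp hq
      have hpx := hp.2.ne
      have hqx := hq.2.ne
      have hps := hp.2.symm
      have hqs := hq.2.symm
      have hwvs := hvw.symm
      grind
    rw [card_erase_of_mem hmem, hX', smul_eq_mul, mul_one] at h2
    omega
  rw [adjCount_union_self hdisj] at hext
  have h5 := (four_mul_wheelBound (#X + 1 + #Y)).2
  have hX2 : 2 ≤ #X := by
    rw [← card_pair hvy.ne]
    refine card_le_card fun u hu => ?_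
    rw [mem_insert, mem_singleton] at hu
    rcases hu with rfl | rfl <;> assumption
  generalize adjCount G Y Y = I₁ at *
  generalize adjCount G Y (insert w X) = I₂ at *
  generalize adjCount G (insert w X) (insert w X) = I₃ at *
  generalize wheelBound (#X + 1 + #Y) = g at *
  generalize #X = p at *
  generalize #Y = q at *
  clear hX hXw hY hXa hYa hdisj hX' hW
  zify at *
  -- This rearranges to `(p + 1 - q)² + 4q ≤ 6`, which is impossible for `p ≥ 2`.
  have h6 : ((p : ℤ) + 1 + q) ^ 2 + 2 * (p + 1 + q) ≤ 2 * (p + 2 + q + 2 * (q * p)) + 4 := by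
    linarith
  rcases lt_or_ge (q : ℤ) 2 with hq | hq
  · have : (q : ℤ) = 0 ∨ (q : ℤ) = 1 := by omega
    rcases this with h | h <;> rw [h] at h6 hcard <;> nlinarith
  · nlinarith [sq_nonneg ((p : ℤ) + 1 - q)]

end Structure

/-! ### Almost extremal wheel-free graphs have a near colouring -/

section Structure

open scoped Classical

variable {V : Type*} {G : SimpleGraph V}

theorem adjCount_eq_zero {s t : Finset V} (h : ∀ x ∈ s, ∀ y ∈ t, ¬ G.Adj x y) :
    adjCount G t s = 0 := by
  rw [adjCount_comm]
  exact sum_eq_zero fun x hx => card_eq_zero.2 (filter_eq_empty_iff.2 fun y hy => h x hx y hy)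

/-- In a wheel-free graph, a vertex `w` with exactly one neighbour in a four-clique can be added
to one of the two classes of the other vertices when these span as many edges as possible. -/
theorem exists_isNearColoring_of_exceptional (hW : WheelFree G) {a b c d w : V} {X Y : Finset V}
    (h : IsFourClique G a b c d)
    (hX : ∀ x ∈ X, (x ≠ a ∧ x ≠ b ∧ x ≠ c ∧ x ≠ d) ∧
      G.Adj x a ∧ G.Adj x b ∧ ¬ G.Adj x c ∧ ¬ G.Adj x d)
    (hY : ∀ x ∈ Y, (x ≠ a ∧ x ≠ b ∧ x ≠ c ∧ x ≠ d) ∧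
      ¬ G.Adj x a ∧ ¬ G.Adj x b ∧ G.Adj x c ∧ G.Adj x d)
    (hXp : ∀ v ∈ X, ∀ x ∈ X, ∀ y ∈ X, G.Adj v x → G.Adj v y → x = y)
    (hYp : ∀ v ∈ Y, ∀ x ∈ Y, ∀ y ∈ Y, G.Adj v x → G.Adj v y → x = y)
    (hwX : w ∉ X) (hwY : w ∉ Y) (hXY : Disjoint X Y)
    (hwa : G.Adj w a) (hwc : ¬ G.Adj w c) (hwd : ¬ G.Adj w d)
    (hall : ∀ x, x = a ∨ x = b ∨ x = c ∨ x = d ∨ x = w ∨ x ∈ X ∨ x ∈ Y)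
    (hcard : 4 ≤ #X + 1 + #Y)
    (hext : 2 * wheelBound (#X + 1 + #Y) ≤ adjCount G (insert w X ∪ Y) (insert w X ∪ Y)) :
    ∃ C : V → Fin 2, IsNearColoring G C := by
  have hXw : ∀ x ∈ X, ∀ y ∈ X, G.Adj w x → G.Adj w y → x = y := by
    intro x hx y hy wx wy
    by_contra hxy
    -- The hub is `a` and the rim is `b, x, w, y`.
    exact hW h.ab (hX x hx).2.1.symm hwa.symm (hX y hy).2.1.symm (hX x hx).2.2.1.symm wx.symm wy
      (hX y hy).2.2.1 (fun hbw => hwc (hbw ▸ h.bc)) hxy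
  have hno : ∀ v ∈ X, ∀ y ∈ X, G.Adj v w → G.Adj v y → False := fun v hv y hy vw vy =>
    not_adj_of_extremal hW hwX hwY hXY hwa (fun x hx => (hX x hx).2.1) (fun y hy => (hY y hy).1.1)
      hXp hXw hYp hcard hext hv hy vw vy
  refine exists_isNearColoring_of_classes (a := a) (b := b) (c := c) (d := d)
    (P := fun x => x ∈ X ∨ x = w) (Q := (· ∈ Y)) ?_ ?_ ?_ ?_ (fun x hx => (hY x hx).2.1)
    (fun x hx => (hY x hx).2.2.1) h.ab h.ac.ne h.ad.ne h.bc.ne h.bd.ne ?_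
    (fun v x y hv hx hy => hYp v hv x hx y hy)
  · intro x
    have := hall x
    tauto
  · rintro x (hx | rfl)
    exacts [(hX x hx).2.2.2.1, hwc]
  · rintro x (hx | rfl)
    exacts [(hX x hx).2.2.2.2, hwd]
  · rintro x (hx | rfl)
    exacts [(hX x hx).2.1, hwa]
  · rintro v x y (hv | rfl) (hx | rfl) (hy | rfl) vx vy
    · exact hXp v hv x hx y hy vx vy
    · exact (hno v hv x hx vy vx).elim
    · exact (hno v hv y hy vx vy).elim
    · rfl
    · exact hXw x hx y hy vx vy
    · exact (G.irrefl vy).elim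
    · exact (G.irrefl vx).elim
    · rfl

/-- If all vertices outside a four-clique are adjacent to exactly two of its vertices, and they do
not split into two sets without edges between them, then there is a near colouring. One
exceptional vertex `w` with only one neighbour in the four-clique is allowed when the vertices
outside span as many edges as possible. -/
theorem exists_isNearColoring_of_unsplit (hW : WheelFree G) {a b c d : V} {U : Finset V}
    (h : IsFourClique G a b c d)
    (hU : ∀ x ∈ U, (x ≠ a ∧ x ≠ b ∧ x ≠ c ∧ x ≠ d) ∧ degFour G a b c d x = 2)
    (hsplit : ∀ P Q : Finset V, P.Nonempty → Q.Nonempty → Disjoint P Q → P ∪ Q = U →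
      (∀ x ∈ P, ∀ y ∈ Q, ¬ G.Adj x y) → False)
    (hw : (∀ x, x = a ∨ x = b ∨ x = c ∨ x = d ∨ x ∈ U) ∨
      ∃ w ∉ U, (∀ x, x = a ∨ x = b ∨ x = c ∨ x = d ∨ x = w ∨ x ∈ U) ∧
        degFour G a b c d w = 1 ∧ 4 ≤ #U + 1 ∧
        2 * wheelBound (#U + 1) ≤ adjCount G (insert w U) (insert w U))
    {u : V} (hu : u ∈ U) (hua : G.Adj u a) (hub : G.Adj u b) :
    ∃ C : V → Fin 2, IsNearColoring G C := by
  -- By `pairing_of_adj` no edge leaves the set of vertices seeing `{a, b}` or `{c, d}`. It contains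
  -- `u`, so it is all of `U`.
  have hpair : ∀ x ∈ U, (G.Adj x a ↔ G.Adj x b) := by
    by_contra hcon
    push Not at hcon
    obtain ⟨x, hx, hx'⟩ := hcon
    refine hsplit {x ∈ U | G.Adj x a ↔ G.Adj x b} {x ∈ U | ¬ (G.Adj x a ↔ G.Adj x b)}
      ⟨u, by simp [hu, hua, hub]⟩ ⟨x, mem_filter.2 ⟨hx, by tauto⟩⟩ (disjoint_filter_filter_not _ _ _)
      (filter_union_filter_not_eq _ _) ?_
    intro p hp q hq hpq
    rw [mem_filter] at hp hq
    exact hq.2 (pairing_of_adj hW h hpq (hU p hp.1).2 (hU q hq.1).2 (hU p hp.1).1 (hU q hq.1).1 hp.2)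
  set X := {x ∈ U | G.Adj x a} with hX
  set Y := {x ∈ U | ¬ G.Adj x a} with hY
  have hXU : ∀ x ∈ X, (x ≠ a ∧ x ≠ b ∧ x ≠ c ∧ x ≠ d) ∧
      G.Adj x a ∧ G.Adj x b ∧ ¬ G.Adj x c ∧ ¬ G.Adj x d := by
    intro x hx
    rw [hX, mem_filter] at hx
    have := degFour_eq_two (hU x hx.1).2
    have := hpair x hx.1
    have := (hU x hx.1).1
    tauto
  have hYU : ∀ x ∈ Y, (x ≠ a ∧ x ≠ b ∧ x ≠ c ∧ x ≠ d) ∧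
      ¬ G.Adj x a ∧ ¬ G.Adj x b ∧ G.Adj x c ∧ G.Adj x d := by
    intro x hx
    rw [hY, mem_filter] at hx
    have := degFour_eq_two (hU x hx.1).2
    have := hpair x hx.1
    have := (hU x hx.1).1
    tauto
  have hmem : ∀ x ∈ U, x ∈ X ∨ x ∈ Y := by
    intro x hx
    rw [hX, hY, mem_filter, mem_filter]
    tauto
  -- A path `x, v, y` inside a class gives the rim `q, x, v, y` around the hub `p`.
  have path : ∀ p q, G.Adj p q → ∀ v x y, G.Adj v p → G.Adj x p → G.Adj x q → G.Adj y p →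
      G.Adj y q → v ≠ q → G.Adj v x → G.Adj v y → x = y := by
    intro p q pq v x y vp xp xq yp yq vq vx vy
    by_contra hxy
    exact hW pq xp.symm vp.symm yp.symm xq.symm vx.symm vy yq vq.symm hxy
  have hXp : ∀ v ∈ X, ∀ x ∈ X, ∀ y ∈ X, G.Adj v x → G.Adj v y → x = y :=
    fun v hv x hx y hy => path a b h.ab v x y (hXU v hv).2.1 (hXU x hx).2.1 (hXU x hx).2.2.1
      (hXU y hy).2.1 (hXU y hy).2.2.1 (hXU v hv).1.2.1
  have hYp : ∀ v ∈ Y, ∀ x ∈ Y, ∀ y ∈ Y, G.Adj v x → G.Adj v y → x = y :=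
    fun v hv x hx y hy => path c d h.cd v x y (hYU v hv).2.2.2.1 (hYU x hx).2.2.2.1
      (hYU x hx).2.2.2.2 (hYU y hy).2.2.2.1 (hYU y hy).2.2.2.2 (hYU v hv).1.2.2.2
  rcases hw with hall | ⟨w, hwU, hall, hwd, hcard, hext⟩
  · refine exists_isNearColoring_of_classes (a := a) (b := b) (c := c) (d := d)
      (P := (· ∈ X)) (Q := (· ∈ Y)) ?_ (fun x hx => (hXU x hx).2.2.2.1)
      (fun x hx => (hXU x hx).2.2.2.2) (fun x hx => (hXU x hx).2.1) (fun x hx => (hYU x hx).2.1)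
      (fun x hx => (hYU x hx).2.2.1) h.ab h.ac.ne h.ad.ne h.bc.ne h.bd.ne
      (fun v x y hv hx hy => hXp v hv x hx y hy) (fun v x y hv hx hy => hYp v hv x hx y hy)
    intro x
    have := hmem x
    have := hall x
    tauto
  · have hwX : w ∉ X := fun hx => hwU (mem_filter.1 hx).1
    have hwY : w ∉ Y := fun hx => hwU (mem_filter.1 hx).1
    have hXY : Disjoint X Y := disjoint_filter_filter_not _ _ _
    have hUn : X ∪ Y = U := filter_union_filter_not_eq _ _
    have hc : #U = #X + #Y := by rw [← hUn, card_union_of_disjoint hXY]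
    have hall' : ∀ x, x = a ∨ x = b ∨ x = c ∨ x = d ∨ x = w ∨ x ∈ X ∨ x ∈ Y := by
      intro x
      have h1 := hmem x
      have h2 := hall x
      clear * - h1 h2
      tauto
    have hins : insert w X ∪ Y = insert w U := by rw [insert_union, hUn]
    have hins' : insert w Y ∪ X = insert w U := by rw [insert_union, union_comm, hUn]
    have e1 : #X + 1 + #Y = #U + 1 := by omega
    have e2 : #Y + 1 + #X = #U + 1 := by omega
    have hX' : ∀ x ∈ X, (x ≠ b ∧ x ≠ a ∧ x ≠ c ∧ x ≠ d) ∧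
        G.Adj x b ∧ G.Adj x a ∧ ¬ G.Adj x c ∧ ¬ G.Adj x d := fun x hx => by
      have := hXU x hx; clear * - this; tauto
    have hY' : ∀ x ∈ Y, (x ≠ b ∧ x ≠ a ∧ x ≠ c ∧ x ≠ d) ∧
        ¬ G.Adj x b ∧ ¬ G.Adj x a ∧ G.Adj x c ∧ G.Adj x d := fun x hx => by
      have := hYU x hx; clear * - this; tauto
    rcases degFour_eq_one hwd with hw | hw | hw | hw
    · exact exists_isNearColoring_of_exceptional hW h hXU hYU hXp hYp hwX hwY hXY hw.1
        hw.2.2.1 hw.2.2.2 hall' (by omega) (by rw [e1, hins]; exact hext)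
    · exact exists_isNearColoring_of_exceptional hW
        (.of_adj h.ab.symm h.bc h.bd h.ac h.ad h.cd) hX' hY' hXp hYp hwX hwY hXY hw.2.1
        hw.2.2.1 hw.2.2.2 (fun x => by have := hall' x; clear * - this; tauto) (by omega)
        (by rw [e1, hins]; exact hext)
    · exact exists_isNearColoring_of_exceptional hW
        (.of_adj h.cd h.ac.symm h.bc.symm h.ad.symm h.bd.symm h.ab)
        (fun x hx => by have := hYU x hx; clear * - this; tauto) (fun x hx => by have := hXU x hx; clear * - this; tauto)
        hYp hXp hwY hwX hXY.symm hw.2.2.1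
        hw.1 hw.2.1 (fun x => by have := hall' x; clear * - this; tauto) (by omega)
        (by rw [e2, hins']; exact hext)
    · exact exists_isNearColoring_of_exceptional hW
        (.of_adj h.cd.symm h.ad.symm h.bd.symm h.ac.symm h.bc.symm h.ab)
        (fun x hx => by have := hYU x hx; clear * - this; tauto) (fun x hx => by have := hXU x hx; clear * - this; tauto)
        hYp hXp hwY hwX hXY.symm hw.2.2.2
        hw.1 hw.2.1 (fun x => by have := hall' x; clear * - this; tauto) (by omega)
        (by rw [e2, hins']; exact hext)

/-- The loss against the bound is at most one, shared between the edges inside `R` and those from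
`R` to a four-clique. Either every outer vertex has two neighbours in the clique, or a single one
has exactly one and `R` attains the bound. In both cases superadditivity of `wheelBound` rules out a
split of the regular outer vertices. -/
theorem WheelFree.exists_isNearColoring [Fintype V] (hW : WheelFree G)
    (hn : 8 ≤ Fintype.card V) (hG : wheelBound (Fintype.card V) ≤ size G + 1) :
    ∃ C : V → Fin 2, IsNearColoring G C := by
  have hsize := two_mul_size (G := G)
  obtain ⟨-, hK⟩ := hW.adjCount_le univ
  rw [card_univ] at hK
  obtain ⟨a, b, c, d, h⟩ : ∃ a b c d, IsFourClique G a b c d := by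
    by_contra hcon
    push Not at hcon
    have := (hK fun a _ b _ c _ d _ => hcon a b c d).2 hn
    omega
  set R : Finset V := univ \ {a, b, c, d} with hR
  have hRmem : ∀ x, x ∈ R ↔ (x ≠ a ∧ x ≠ b ∧ x ≠ c ∧ x ≠ d) := by simp [hR]
  have hcardR : #R + 4 = Fintype.card V := by
    rw [hR, ← card_univ, ← h.card_eq]
    exact card_sdiff_add_card_eq_card (subset_univ _)
  have hbound : wheelBound (Fintype.card V) = wheelBound #R + 2 * #R + 6 := by
    rw [← hcardR, wheelBound_add_four]
  have hsum := adjCount_sdiff_self (G := G) (subset_univ ({a, b, c, d} : Finset V))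
  have hS := adjCount_self_le (G := G) {a, b, c, d}
  rw [h.card_eq] at hS
  have hRle := (hW.adjCount_le R).1
  have hRS : adjCount G R {a, b, c, d} = ∑ x ∈ R, degFour G a b c d x :=
    sum_congr rfl fun x _ => h.card_filter_adj x
  rw [← hR, hRS] at hsum
  have hdeg : ∀ x ∈ R, degFour G a b c d x ≤ 2 := by
    intro x hx
    rw [hRmem] at hx
    exact h.degFour_le_two hW hx.1 hx.2.1 hx.2.2.1 hx.2.2.2
  have hdegsum : ∑ x ∈ R, degFour G a b c d x ≤ #R * 2 := by
    simpa using sum_le_card_nsmul R _ 2 hdeg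
  obtain ⟨U, hUR, hU, hw, hsplit⟩ : ∃ U ⊆ R, (∀ x ∈ U, degFour G a b c d x = 2) ∧
      ((∀ x, x = a ∨ x = b ∨ x = c ∨ x = d ∨ x ∈ U) ∨
      ∃ w ∉ U, (∀ x, x = a ∨ x = b ∨ x = c ∨ x = d ∨ x = w ∨ x ∈ U) ∧
        degFour G a b c d w = 1 ∧ 4 ≤ #U + 1 ∧
        2 * wheelBound (#U + 1) ≤ adjCount G (insert w U) (insert w U)) ∧
      (∀ P Q : Finset V, P.Nonempty → Q.Nonempty → Disjoint P Q → P ∪ Q = U →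
      (∀ x ∈ P, ∀ y ∈ Q, ¬ G.Adj x y) → False) := by
    by_cases hall : ∀ x ∈ R, degFour G a b c d x = 2
    · refine ⟨R, Subset.rfl, hall, Or.inl fun x => by rw [hRmem]; tauto, ?_⟩
      intro P Q hP hQ hPQ hun hno
      have h1 := adjCount_union_self (G := G) hPQ
      rw [adjCount_eq_zero hno, hun] at h1
      have h2 := (hW.adjCount_le P).1
      have h3 := (hW.adjCount_le Q).1
      have h4 : #R = #P + #Q := by rw [← hun, card_union_of_disjoint hPQ]
      have h5 := wheelBound_add_lt hP.card_pos hQ.card_pos (by omega)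
      rw [← h4] at h5
      omega
    · push Not at hall
      obtain ⟨w, hwR, hw2⟩ := hall
      have hlt : degFour G a b c d w ≤ 1 := by
        have := hdeg w hwR
        omega
      have hsplitsum := add_sum_erase R (degFour G a b c d) hwR
      have hcardw := card_erase_add_one hwR
      have hle : ∑ x ∈ R.erase w, degFour G a b c d x ≤ ∑ x ∈ R.erase w, 2 :=
        sum_le_sum fun x hx => hdeg x (mem_of_mem_erase hx)
      have hle' := hle
      rw [sum_const, smul_eq_mul] at hle'
      -- The vertex `w` already accounts for the one lost edge, so nothing else can be lost.
      have heq : ∑ x ∈ R.erase w, degFour G a b c d x = ∑ x ∈ R.erase w, 2 := by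
        rw [sum_const, smul_eq_mul]
        omega
      have hall := (sum_eq_sum_iff_of_le fun x hx => hdeg x (mem_of_mem_erase hx)).1 heq
      have hRext : 2 * wheelBound #R ≤ adjCount G R R := by omega
      refine ⟨R.erase w, erase_subset _ _, hall, Or.inr ⟨w, notMem_erase _ _, ?_, by omega,
        by omega, by rwa [hcardw, insert_erase hwR]⟩, ?_⟩
      · intro x
        rw [mem_erase, hRmem]
        tauto
      · intro P Q hP hQ hPQ hun hno
        have hwPQ : w ∉ P ∪ Q := hun ▸ notMem_erase w R
        have hwP : Disjoint {w} P := by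
          rw [disjoint_singleton_left]
          exact fun hw => hwPQ (mem_union_left _ hw)
        have hwQ : Disjoint {w} Q := by
          rw [disjoint_singleton_left]
          exact fun hw => hwPQ (mem_union_right _ hw)
        have h1 := adjCount_union_self (G := G) hPQ
        have h2 := adjCount_union_self (G := G) hwP
        have h3 := adjCount_union_self (G := G) hwQ
        have h4 := adjCount_union_self (G := G) (disjoint_singleton_left.2 hwPQ)
        rw [adjCount_eq_zero hno] at h1
        have h10 := adjCount_union_left (G := G) hPQ {w}
        rw [hun] at h1 h4 h10
        rw [← insert_eq, insert_erase hwR] at h4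
        have h5 := (hW.adjCount_le ({w} ∪ P)).1
        have h6 := (hW.adjCount_le ({w} ∪ Q)).1
        rw [card_union_of_disjoint hwP, card_singleton, add_comm 1] at h5
        rw [card_union_of_disjoint hwQ, card_singleton, add_comm 1] at h6
        have h7 : #P + #Q = #(R.erase w) := by rw [← hun, card_union_of_disjoint hPQ]
        have h8 := wheelBound_succ_add_lt hP.card_pos hQ.card_pos (by omega)
        rw [h7, hcardw] at h8
        have h9 := adjCount_singleton (G := G) w
        omega
  obtain ⟨u, hu⟩ : U.Nonempty := by
    rw [nonempty_iff_ne_empty]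
    rintro rfl
    rcases hw with hall | ⟨w, -, -, -, h4, -⟩
    · have : R = ∅ := by
        rw [eq_empty_iff_forall_notMem]
        intro x hx
        rw [hRmem] at hx
        have := hall x
        simp at this
        tauto
      rw [this] at hcardR
      simp at hcardR
      omega
    · simp at h4
  have hU' : ∀ x ∈ U, (x ≠ a ∧ x ≠ b ∧ x ≠ c ∧ x ≠ d) ∧ degFour G a b c d x = 2 :=
    fun x hx => ⟨(hRmem x).1 (hUR hx), hU x hx⟩
  -- Relabelling the clique lets the two clique neighbours of `u` come first.
  have perm : ∀ a' b' c' d', IsFourClique G a' b' c' d' →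
      (∀ x, (x = a' ∨ x = b' ∨ x = c' ∨ x = d') ↔ (x = a ∨ x = b ∨ x = c ∨ x = d)) →
      (∀ x, degFour G a' b' c' d' x = degFour G a b c d x) →
      G.Adj u a' → G.Adj u b' → ∃ C : V → Fin 2, IsNearColoring G C := by
    intro a' b' c' d' h' hset hdeg' ua ub
    refine exists_isNearColoring_of_unsplit hW h' (fun x hx => ⟨?_, ?_⟩) hsplit ?_ hu ua ub
    · have h1 := hset x
      have h2 := (hU' x hx).1
      clear * - h1 h2
      tauto
    · rw [hdeg', hU x hx]
    · simp only [hdeg']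
      refine hw.imp (fun H x => ?_) (fun ⟨w, hwU, H, H'⟩ => ⟨w, hwU, fun x => ?_, H'⟩)
      · have h1 := hset x
        have h2 := H x
        clear * - h1 h2
        tauto
      · have h1 := hset x
        have h2 := H x
        clear * - h1 h2
        tauto
  rcases degFour_eq_two (hU u hu) with hu' | hu' | hu' | hu' | hu' | hu'
  · exact perm a b c d h (fun x => by clear * -; tauto) (fun x => rfl) hu'.1 hu'.2.1
  · exact perm a c b d (.of_adj h.ac h.ab h.ad h.bc.symm h.cd h.bd) (fun x => by clear * -; tauto)
      (fun x => by clear * -; unfold degFour; omega) hu'.1 hu'.2.2.1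
  · exact perm a d b c (.of_adj h.ad h.ab h.ac h.bd.symm h.cd.symm h.bc) (fun x => by clear * -; tauto)
      (fun x => by clear * -; unfold degFour; omega) hu'.1 hu'.2.2.2
  · exact perm b c a d (.of_adj h.bc h.ab.symm h.bd h.ac.symm h.cd h.ad) (fun x => by clear * -; tauto)
      (fun x => by clear * -; unfold degFour; omega) hu'.2.1 hu'.2.2.1
  · exact perm b d a c (.of_adj h.bd h.ab.symm h.bc h.ad.symm h.cd.symm h.ac) (fun x => by clear * -; tauto)
      (fun x => by clear * -; unfold degFour; omega) hu'.2.1 hu'.2.2.2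
  · exact perm c d a b (.of_adj h.cd h.ac.symm h.bc.symm h.ad.symm h.bd.symm h.ab)
      (fun x => by clear * -; tauto) (fun x => by clear * -; unfold degFour; omega) hu'.2.2.1 hu'.2.2.2

end Structure

/-! ### Maximum matchings and the class `G_{n,4}` -/

section Matching

open scoped Classical

variable {V : Type*}

theorem two_mul_ncard_edgeSet_of_isMatching [Fintype V] {M : (⊤ : SimpleGraph V).Subgraph}
    (hM : M.IsMatching) : 2 * M.edgeSet.ncard = M.verts.ncard := by
  have h := two_mul_size (G := M.spanningCoe)
  unfold size at h
  rw [Subgraph.edgeSet_spanningCoe] at h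
  rw [h, Set.ncard_eq_toFinset_card', card_eq_sum_ones]
  unfold adjCount
  have h1 : ∀ v, #{w ∈ univ | M.spanningCoe.Adj v w} = if v ∈ M.verts then 1 else 0 := by
    intro v
    split_ifs with hv
    · obtain ⟨w, hw, hw'⟩ := hM hv
      rw [card_eq_one]
      refine ⟨w, ?_⟩
      ext x
      simp only [mem_filter, mem_univ, true_and, Subgraph.spanningCoe_adj, mem_singleton]
      exact ⟨hw' x, fun hx => hx ▸ hw⟩
    · rw [card_eq_zero, filter_eq_empty_iff]
      intro w _ hw
      exact hv (M.edge_vert hw)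
  simp only [h1]
  rw [← sum_filter]
  refine sum_congr ?_ fun _ _ => rfl
  ext v
  simp

/-- A matching missing two vertices `u, v` of `S` can be enlarged by the edge `uv`. -/
theorem exists_isMatching_add_edge [Finite V] {S : Set V} {M : (⊤ : SimpleGraph V).Subgraph}
    (hM : M.IsMatching) (hS : M.verts ⊆ S) {u v : V} (hu : u ∈ S) (hv : v ∈ S)
    (huM : u ∉ M.verts) (hvM : v ∉ M.verts) (huv : u ≠ v) :
    ∃ N : (⊤ : SimpleGraph V).Subgraph, N.IsMatching ∧ N.verts ⊆ S ∧ M ≤ N ∧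
      M.edgeSet.ncard < N.edgeSet.ncard := by
  have hadj : (⊤ : SimpleGraph V).Adj u v := huv
  refine ⟨M ⊔ (⊤ : SimpleGraph V).subgraphOfAdj hadj,
    hM.sup (Subgraph.IsMatching.subgraphOfAdj hadj) ?_, ?_, le_sup_left, ?_⟩
  · rw [hM.support_eq_verts, (Subgraph.IsMatching.subgraphOfAdj hadj).support_eq_verts,
      Set.disjoint_left]
    rintro x hx hx'
    simp only [subgraphOfAdj_verts, Set.mem_insert_iff, Set.mem_singleton_iff] at hx'
    rcases hx' with rfl | rfl
    exacts [huM hx, hvM hx]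
  · rw [Subgraph.verts_sup]
    refine Set.union_subset hS ?_
    rintro x hx
    simp only [subgraphOfAdj_verts, Set.mem_insert_iff, Set.mem_singleton_iff] at hx
    rcases hx with rfl | rfl <;> assumption
  · rw [Subgraph.edgeSet_sup, edgeSet_subgraphOfAdj]
    refine Set.ncard_lt_ncard ?_ (Set.toFinite _)
    refine ⟨Set.subset_union_left, fun hsub => huM ?_⟩
    have : s(u, v) ∈ M.edgeSet := hsub (Or.inr rfl)
    rw [Subgraph.mem_edgeSet] at this
    exact M.edge_vert this

/-- In a complete graph, a matching that cannot be enlarged misses at most one vertex of `S`. -/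
theorem verts_ncard_of_maximal [Fintype V] {S : Set V} {M : (⊤ : SimpleGraph V).Subgraph}
    (hM : M.IsMatching) (hS : M.verts ⊆ S)
    (hmax : ∀ N : (⊤ : SimpleGraph V).Subgraph, N.IsMatching → N.verts ⊆ S → M ≤ N →
      N.edgeSet.ncard ≤ M.edgeSet.ncard) :
    M.edgeSet.ncard = S.ncard / 2 := by
  have h1 := two_mul_ncard_edgeSet_of_isMatching hM
  have h2 : (S \ M.verts).ncard ≤ 1 := by
    rw [Set.ncard_le_one]
    intro u hu v hv
    by_contra huv
    obtain ⟨N, hN, hNS, hMN, hlt⟩ :=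
      exists_isMatching_add_edge hM hS hu.1 hv.1 hu.2 hv.2 huv
    exact absurd (hmax N hN hNS hMN) (by omega)
  have h3 := Set.ncard_sdiff_add_ncard_of_subset hS
  omega

theorem IsMaximumMatchingOn.ncard_edgeSet [Fintype V] {S : Set V}
    {M : (⊤ : SimpleGraph V).Subgraph} (h : IsMaximumMatchingOn S M) :
    M.edgeSet.ncard = S.ncard / 2 :=
  verts_ncard_of_maximal h.1 h.2.1 fun N hN hNS _ => h.2.2 N hN hNS

theorem exists_isMaximumMatchingOn_ge [Fintype V] {S : Set V} {M : (⊤ : SimpleGraph V).Subgraph}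
    (hM : M.IsMatching) (hS : M.verts ⊆ S) : ∃ N, M ≤ N ∧ IsMaximumMatchingOn S N := by
  obtain ⟨N, ⟨hN, hNS, hMN⟩, hmax⟩ := Set.exists_max_image
    {N : (⊤ : SimpleGraph V).Subgraph | N.IsMatching ∧ N.verts ⊆ S ∧ M ≤ N}
    (fun N => N.edgeSet.ncard) (Set.toFinite _) ⟨M, hM, hS, le_rfl⟩
  refine ⟨N, hMN, hN, hNS, fun N' hN' hNS' => ?_⟩
  rw [verts_ncard_of_maximal hN hNS fun N'' h1 h2 h3 => hmax N'' ⟨h1, h2, hMN.trans h3⟩]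
  have h1 := two_mul_ncard_edgeSet_of_isMatching hN'
  have h2 := Set.ncard_le_ncard hNS'
  omega

/-- The complete bipartite graph given by `c` with matchings `M i` added. -/
def matchedGraph (c : V → Fin 2) (M : Fin 2 → (⊤ : SimpleGraph V).Subgraph) : SimpleGraph V :=
  (⊤ : SimpleGraph (Fin 2)).comap c ⊔ ⨆ i : Fin 2, (M i).spanningCoe

theorem matchedGraph_adj {c : V → Fin 2} {M : Fin 2 → (⊤ : SimpleGraph V).Subgraph}
    (hM : ∀ i, (M i).verts ⊆ c ⁻¹' {i}) {v w : V} :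
    (matchedGraph c M).Adj v w ↔ c v ≠ c w ∨ c v = c w ∧ (M (c v)).Adj v w := by
  unfold matchedGraph
  rw [sup_adj, iSup_adj, comap_adj, top_adj]
  constructor
  · rintro (h | ⟨i, h⟩)
    · exact Or.inl h
    · have h1 : c v = i := hM i ((M i).edge_vert h)
      have h2 : c w = i := hM i ((M i).edge_vert h.symm)
      subst h1
      exact Or.inr ⟨h2.symm, h⟩
  · rintro (h | ⟨-, h⟩)
    · exact Or.inl h
    · exact Or.inr ⟨c v, h⟩

theorem matchedGraph_isNearColoring {c : V → Fin 2} {M : Fin 2 → (⊤ : SimpleGraph V).Subgraph}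
    (hM : ∀ i, IsMaximumMatchingOn (c ⁻¹' {i}) (M i)) : IsNearColoring (matchedGraph c M) c := by
  intro v x y hx hy ex ey
  rw [matchedGraph_adj fun i => (hM i).2.1] at hx hy
  have hx' := hx.resolve_left fun h => h ex.symm
  have hy' := hy.resolve_left fun h => h ey.symm
  exact (hM (c v)).1.eq_of_adj_left hx'.2 hy'.2

theorem adjCount_matchedGraph_self [Fintype V] {c : V → Fin 2}
    {M : Fin 2 → (⊤ : SimpleGraph V).Subgraph}
    (hM : ∀ i, IsMaximumMatchingOn (c ⁻¹' {i}) (M i)) (i : Fin 2) :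
    adjCount (matchedGraph c M) {v | c v = i} {v | c v = i} = 2 * ((c ⁻¹' {i}).ncard / 2) := by
  rw [← (hM i).ncard_edgeSet, two_mul_ncard_edgeSet_of_isMatching (hM i).1,
    Set.ncard_eq_toFinset_card', card_eq_sum_ones]
  unfold adjCount
  symm
  have hsub : (M i).verts.toFinset ⊆ ({v | c v = i} : Finset V) := fun v hv =>
    mem_filter.2 ⟨mem_univ _, (hM i).2.1 (Set.mem_toFinset.1 hv)⟩
  have hadj : ∀ v w, c v = i → (w ∈ ({w | c w = i} : Finset V) ∧ (matchedGraph c M).Adj v w ↔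
      (M i).Adj v w) := by
    rintro v w rfl
    rw [matchedGraph_adj fun i => (hM i).2.1, mem_filter]
    constructor
    · rintro ⟨h1, h2⟩
      exact (h2.resolve_left fun h => h h1.2.symm).2
    · intro h
      have : c w = c v := (hM (c v)).2.1 ((M (c v)).edge_vert h.symm)
      exact ⟨⟨mem_univ _, this⟩, Or.inr ⟨this.symm, h⟩⟩
  rw [← sum_subset hsub (f := fun v => #{w ∈ ({w | c w = i} : Finset V) | (matchedGraph c M).Adj v w})]
  · refine sum_congr rfl fun v hv => ?_
    rw [Set.mem_toFinset] at hv
    obtain ⟨w, hw, hw'⟩ := (hM i).1 hv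
    symm
    rw [card_eq_one]
    refine ⟨w, ?_⟩
    ext x
    rw [mem_filter, hadj v x ((hM i).2.1 hv), mem_singleton]
    exact ⟨hw' x, fun hx => hx ▸ hw⟩
  · intro v hv hv'
    rw [card_eq_zero, eq_empty_iff_forall_notMem]
    intro w hw
    rw [mem_filter, hadj v w (mem_filter.1 hv).2] at hw
    exact hv' (Set.mem_toFinset.2 ((M i).edge_vert hw))

theorem ncard_preimage_eq_card [Fintype V] (c : V → Fin 2) (i : Fin 2) :
    (c ⁻¹' {i}).ncard = #({v | c v = i} : Finset V) := by
  rw [Set.ncard_eq_toFinset_card']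
  congr 1
  ext v
  simp

theorem ncard_preimage_add [Fintype V] (c : V → Fin 2) :
    (c ⁻¹' {0}).ncard + (c ⁻¹' {1}).ncard = Fintype.card V := by
  rw [ncard_preimage_eq_card, ncard_preimage_eq_card, ← card_univ,
    ← card_filter_add_card_filter_not (s := univ) (fun v => c v = 0)]
  congr 2
  ext v
  simp only [mem_filter, mem_univ, true_and]
  omega

theorem size_matchedGraph [Fintype V] {c : V → Fin 2} {M : Fin 2 → (⊤ : SimpleGraph V).Subgraph}
    (hM : ∀ i, IsMaximumMatchingOn (c ⁻¹' {i}) (M i)) :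
    size (matchedGraph c M) = (c ⁻¹' {0}).ncard * (c ⁻¹' {1}).ncard +
      (c ⁻¹' {0}).ncard / 2 + (c ⁻¹' {1}).ncard / 2 := by
  have h := two_mul_size (G := matchedGraph c M)
  have hdisj : Disjoint ({v | c v = 0} : Finset V) ({v | c v = 1} : Finset V) := by
    rw [Finset.disjoint_left]
    intro v hv hv'
    rw [mem_filter] at hv hv'
    omega
  have hun : ({v | c v = 0} : Finset V) ∪ ({v | c v = 1} : Finset V) = univ := by
    ext v
    simp only [mem_union, mem_filter, mem_univ, true_and, iff_true]
    omega
  have hcross : adjCount (matchedGraph c M) ({v | c v = 1} : Finset V) ({v | c v = 0} : Finset V) =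
      (c ⁻¹' {0}).ncard * (c ⁻¹' {1}).ncard := by
    rw [ncard_preimage_eq_card, ncard_preimage_eq_card, mul_comm]
    unfold adjCount
    rw [sum_const_nat (m := #({v | c v = 0} : Finset V))]
    intro v hv
    congr 1
    refine filter_true_of_mem fun w hw => ?_
    rw [matchedGraph_adj fun i => (hM i).2.1]
    rw [mem_filter] at hv hw
    exact Or.inl (by omega)
  rw [← hun, adjCount_union_self hdisj, hcross, adjCount_matchedGraph_self hM,
    adjCount_matchedGraph_self hM] at h
  omega

theorem mem_matchedPartite_two [Fintype V] {G : SimpleGraph V} :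
    G ∈ matchedPartite V 2 ↔ ∃ (c : V → Fin 2) (M : Fin 2 → (⊤ : SimpleGraph V).Subgraph),
      (|((c ⁻¹' {0}).ncard : ℤ) - (c ⁻¹' {1}).ncard| ≤ 2 ∧
        (|((c ⁻¹' {0}).ncard : ℤ) - (c ⁻¹' {1}).ncard| = 2 →
          Even (c ⁻¹' {0}).ncard ∧ Even (c ⁻¹' {1}).ncard)) ∧
      (∀ i, IsMaximumMatchingOn (c ⁻¹' {i}) (M i)) ∧ G = matchedGraph c M := by
  unfold matchedPartite matchedGraph
  simp only [Set.mem_ofPred_eq]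
  refine exists_congr fun c => exists_congr fun M => and_congr_left fun _ => ?_
  constructor
  · exact fun h => h 0 1
  · intro h i j
    have h' := h
    rw [abs_sub_comm] at h'
    fin_cases i <;> fin_cases j
    · simp
    · exact h
    · exact ⟨h'.1, fun h2 => (h'.2 h2).symm⟩
    · simp

theorem wheelFree_of_mem_matchedPartite [Fintype V] {G : SimpleGraph V}
    (hG : G ∈ matchedPartite V 2) : WheelFree G := by
  obtain ⟨c, M, -, hM, rfl⟩ := mem_matchedPartite_two.1 hG
  exact (matchedGraph_isNearColoring hM).wheelFree

theorem size_of_mem_matchedPartite [Fintype V] {G : SimpleGraph V}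
    (hG : G ∈ matchedPartite V 2) : size G = wheelBound (Fintype.card V) := by
  obtain ⟨c, M, hc, hM, rfl⟩ := mem_matchedPartite_two.1 hG
  rw [size_matchedGraph hM, wheelBound_eq_of_balanced hc, ncard_preimage_add]

theorem size_mono [Fintype V] {G H : SimpleGraph V} (h : G ≤ H) : size G ≤ size H :=
  Set.ncard_le_ncard (edgeSet_mono h)

theorem eq_of_le_of_size_le [Fintype V] {G H : SimpleGraph V} (h : G ≤ H)
    (hs : size H ≤ size G) : G = H :=
  edgeSet_injective (Set.eq_of_subset_of_ncard_le (edgeSet_mono h) hs)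

/-- The monochromatic edges form a matching in each class, and these extend to maximum matchings.
The lower bound on the size forces the classes to be balanced. -/
theorem exists_mem_matchedPartite_ge [Fintype V] {G : SimpleGraph V} {C : V → Fin 2}
    (hC : IsNearColoring G C) (hG : wheelBound (Fintype.card V) ≤ size G + 1) :
    ∃ H ∈ matchedPartite V 2, G ≤ H := by
  let M₀ : Fin 2 → (⊤ : SimpleGraph V).Subgraph := fun i =>
    { verts := {v | C v = i ∧ ∃ w, C w = i ∧ G.Adj v w}
      Adj := fun v w => C v = i ∧ C w = i ∧ G.Adj v w
      adj_sub := fun h => h.2.2.ne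
      edge_vert := fun h => ⟨h.1, _, h.2⟩
      symm := ⟨fun _ _ h => ⟨h.2.1, h.1, h.2.2.symm⟩⟩ }
  have hM₀ : ∀ i, (M₀ i).IsMatching := by
    rintro i v ⟨hv, w, hw, hvw⟩
    exact ⟨w, ⟨hv, hw, hvw⟩, fun y hy =>
      hC hy.2.2 hvw (hy.2.1.trans hv.symm) (hw.trans hv.symm)⟩
  choose M hle hM using fun i => exists_isMaximumMatchingOn_ge (S := C ⁻¹' {i}) (hM₀ i)
    fun v hv => hv.1
  have hGH : G ≤ matchedGraph C M := by
    intro v w hvw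
    rw [matchedGraph_adj fun i => (hM i).2.1]
    by_cases h : C v = C w
    · exact Or.inr ⟨h, (hle (C v)).2 ⟨rfl, h.symm, hvw⟩⟩
    · exact Or.inl h
  have hs := size_mono hGH
  rw [size_matchedGraph hM] at hs
  refine ⟨_, mem_matchedPartite_two.2 ⟨C, M, balanced_of_wheelBound_le ?_, hM, rfl⟩, hGH⟩
  rw [ncard_preimage_add]
  omega

theorem matchedPartite_two_nonempty [Fintype V] : (matchedPartite V 2).Nonempty := by
  obtain ⟨A, -, hA⟩ := exists_subset_card_eq (s := (univ : Finset V))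
    (n := Fintype.card V / 2) (by rw [card_univ]; omega)
  let c : V → Fin 2 := fun v => if v ∈ A then 0 else 1
  have h0 : (c ⁻¹' {0}).ncard = Fintype.card V / 2 := by
    rw [ncard_preimage_eq_card, ← hA]
    congr 1
    ext v
    simp [c]
  have h1 := ncard_preimage_add c
  choose M hle hM using fun i => exists_isMaximumMatchingOn_ge (S := c ⁻¹' {i})
    (M := (⊥ : (⊤ : SimpleGraph V).Subgraph)) (fun v hv => hv.elim) (fun v hv => hv.elim)
  refine ⟨_, mem_matchedPartite_two.2 ⟨c, M, ?_, hM, rfl⟩⟩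
  rw [abs_le]
  refine ⟨by omega, fun h => ?_⟩
  rcases abs_cases (((c ⁻¹' {0}).ncard : ℤ) - (c ⁻¹' {1}).ncard) with h' | h' <;> omega

end Matching

/-! ### The extremal number and the graphs at and just below it -/

section Extremal

variable {V : Type*}

theorem oddCocktailParty_two_free_iff {G : SimpleGraph V} :
    (oddCocktailParty 2).Free G ↔ WheelFree G := by
  constructor
  · intro h v a b c d va vb vc vd ab bc cd da hac hbd
    -- The nonadjacent pairs of the cocktail party graph become the opposite rim vertices `a, c` and
    -- `b, d`.
    let f : (Fin 2 × Fin 2) ⊕ Unit → V := Sum.elim (fun p =>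
      if p.1 = 0 then (if p.2 = 0 then a else c) else (if p.2 = 0 then b else d)) (fun _ => v)
    refine h ⟨⟨⟨f, ?_⟩, ?_⟩⟩
    · rintro (⟨i, j⟩ | u) (⟨i', j'⟩ | u') hxy
      · have hi : i ≠ i' := by
          rintro rfl
          simp [oddCocktailParty, join, cocktailParty] at hxy
        fin_cases i <;> fin_cases i' <;> fin_cases j <;> fin_cases j' <;>
          simp_all [f, G.adj_comm]
      · fin_cases i <;> fin_cases j <;> simp_all [f, G.adj_comm]
      · fin_cases i' <;> fin_cases j' <;> simp_all [f, G.adj_comm]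
      · simp [oddCocktailParty, join] at hxy
    · have := va.ne
      have := vb.ne
      have := vc.ne
      have := vd.ne
      have := ab.ne
      have := bc.ne
      have := cd.ne
      have := da.ne
      rintro (⟨i, j⟩ | u) (⟨i', j'⟩ | u') hxy
      · fin_cases i <;> fin_cases i' <;> fin_cases j <;> fin_cases j' <;> simp_all [f]
      · fin_cases i <;> fin_cases j <;> simp_all [f]
      · fin_cases i' <;> fin_cases j' <;> simp_all [f]
      · rfl
  · rintro h ⟨f⟩
    have hadj : ∀ x y, (oddCocktailParty 2).Adj x y → G.Adj (f x) (f y) :=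
      fun x y hxy => f.toHom.map_adj hxy
    refine @h (f (Sum.inr ())) (f (Sum.inl (0, 0))) (f (Sum.inl (1, 0))) (f (Sum.inl (0, 1)))
      (f (Sum.inl (1, 1))) (hadj _ _ ?_) (hadj _ _ ?_) (hadj _ _ ?_) (hadj _ _ ?_) (hadj _ _ ?_)
      (hadj _ _ ?_) (hadj _ _ ?_) (hadj _ _ ?_) 
      (f.injective.ne (by simp)) (f.injective.ne (by simp)) <;>
      simp [oddCocktailParty, join, cocktailParty]

theorem WheelFree.size_le [Fintype V] {G : SimpleGraph V} (h : WheelFree G) :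
    size G ≤ wheelBound (Fintype.card V) := by
  classical
  have h1 := (h.adjCount_le univ).1
  rw [← two_mul_size, card_univ] at h1
  omega

theorem extremalNumber_eq_wheelBound [Fintype V] :
    extremalNumber (Fintype.card V) (oddCocktailParty 2) = wheelBound (Fintype.card V) := by
  classical
  have key : ∀ G : SimpleGraph V, #G.edgeFinset = size G := fun G => by
    rw [size, Set.ncard_eq_toFinset_card', edgeFinset]
  apply le_antisymm
  · rw [extremalNumber_le_iff]
    intro G _ hG
    have := (oddCocktailParty_two_free_iff.1 hG).size_le
    rw [← key G] at this
    convert this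
  · obtain ⟨H, hH⟩ := matchedPartite_two_nonempty (V := V)
    rw [← size_of_mem_matchedPartite hH, ← key H]
    exact card_edgeFinset_le_extremalNumber
      (oddCocktailParty_two_free_iff.2 (wheelFree_of_mem_matchedPartite hH))

theorem wheelFree_size_eq_iff [Fintype V] (hn : 8 ≤ Fintype.card V) {G : SimpleGraph V} :
    (WheelFree G ∧ size G = wheelBound (Fintype.card V)) ↔ G ∈ matchedPartite V 2 := by
  constructor
  · rintro ⟨hW, hs⟩
    obtain ⟨C, hC⟩ := hW.exists_isNearColoring hn (by omega)
    obtain ⟨H, hH, hGH⟩ := exists_mem_matchedPartite_ge hC (by omega)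
    rwa [eq_of_le_of_size_le hGH (by rw [size_of_mem_matchedPartite hH, hs])]
  · exact fun h => ⟨wheelFree_of_mem_matchedPartite h, size_of_mem_matchedPartite h⟩

theorem size_deleteEdges [Fintype V] {H : SimpleGraph V} {e : Sym2 V} (he : e ∈ H.edgeSet) :
    size (H.deleteEdges {e}) + 1 = size H := by
  unfold size
  rw [edgeSet_deleteEdges]
  exact Set.ncard_sdiff_singleton_add_one he

theorem WheelFree.mono {G H : SimpleGraph V} (h : WheelFree H) (hGH : G ≤ H) : WheelFree G :=
  fun _ _ _ _ _ va vb vc vd ab bc cd da => h (hGH va) (hGH vb) (hGH vc) (hGH vd) (hGH ab)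
    (hGH bc) (hGH cd) (hGH da)

theorem wheelFree_size_add_one_eq_iff [Fintype V] (hn : 8 ≤ Fintype.card V) {G : SimpleGraph V} :
    (WheelFree G ∧ size G + 1 = wheelBound (Fintype.card V)) ↔ G ∈ matchedPartiteMinus V 2 := by
  constructor
  · rintro ⟨hW, hs⟩
    obtain ⟨C, hC⟩ := hW.exists_isNearColoring hn (by omega)
    obtain ⟨H, hH, hGH⟩ := exists_mem_matchedPartite_ge hC (by omega)
    have hHs := size_of_mem_matchedPartite hH
    have hne : ¬ H.edgeSet ⊆ G.edgeSet := fun hsub => by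
      have : size H ≤ size G := Set.ncard_le_ncard hsub
      omega
    obtain ⟨e, heH, heG⟩ := Set.not_subset.1 hne
    refine ⟨H, hH, e, heH, eq_of_le_of_size_le ?_ ?_⟩
    · rw [← edgeSet_subset_edgeSet, edgeSet_deleteEdges]
      exact fun x hx => ⟨edgeSet_mono hGH hx, fun hxe => heG (hxe ▸ hx)⟩
    · have := size_deleteEdges heH
      omega
  · rintro ⟨H, hH, e, he, rfl⟩
    exact ⟨(wheelFree_of_mem_matchedPartite hH).mono (deleteEdges_le _),
      by rw [size_deleteEdges he, size_of_mem_matchedPartite hH]⟩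

end Extremal

/-! ### Dissociation sets and wheels in the complement -/

section Complement

variable {V : Type*}

theorem size_add_size_compl [Fintype V] (G : SimpleGraph V) :
    size G + size Gᶜ = (Fintype.card V).choose 2 := by
  classical
  rw [← card_edgeFinset_top_eq_card_choose_two (V := V)]
  have htop : #(⊤ : SimpleGraph V).edgeFinset = size (⊤ : SimpleGraph V) := by
    rw [size, Set.ncard_eq_toFinset_card', edgeFinset]
  rw [htop]
  unfold size
  rw [← sup_compl_eq_top (x := G), edgeSet_sup, Set.ncard_union_eq]
  exact disjoint_edgeSet.2 disjoint_compl_right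

theorem isDissociationSet_iff {G : SimpleGraph V} {S : Set V} :
    IsDissociationSet G S ↔
      ∀ v ∈ S, ∀ x ∈ S, ∀ y ∈ S, G.Adj v x → G.Adj v y → x = y := by
  unfold IsDissociationSet
  constructor
  · intro h v hv x hx y hy vx vy
    have := Set.encard_le_one_iff.1 (h ⟨v, hv⟩) ⟨x, hx⟩ ⟨y, hy⟩ vx vy
    exact congrArg Subtype.val this
  · intro h v
    rw [Set.encard_le_one_iff]
    intro x y vx vy
    exact Subtype.ext (h v v.2 x x.2 y y.2 vx vy)

theorem le_dissociationNumber [Fintype V] {G : SimpleGraph V} {S : Finset V}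
    (hS : IsDissociationSet G (S : Set V)) : #S ≤ dissociationNumber G := by
  refine le_csSup ⟨Fintype.card V, ?_⟩ ⟨S, hS, rfl⟩
  rintro _ ⟨T, -, rfl⟩
  exact card_le_univ T

theorem dissociationNumber_le [Fintype V] {G : SimpleGraph V} {k : ℕ}
    (h : ∀ S : Finset V, IsDissociationSet G (S : Set V) → #S ≤ k) :
    dissociationNumber G ≤ k := by
  refine csSup_le ⟨0, ∅, ?_, rfl⟩ ?_
  · simp [isDissociationSet_iff]
  · rintro _ ⟨S, hS, rfl⟩
    exact h S hS

/-- A wheel in the complement is a dissociation set with five elements. -/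
theorem wheelFree_compl_of_dissociationNumber_le [Fintype V] {G : SimpleGraph V}
    (h : dissociationNumber G ≤ 4) : WheelFree Gᶜ := by
  classical
  intro v a b c d va vb vc vd ab bc cd da hac hbd
  have hcard : #({v, a, b, c, d} : Finset V) = 5 := by
    have h1 := va.ne
    have h2 := vb.ne
    have h3 := vc.ne
    have h4 := vd.ne
    have h5 := ab.ne
    have h6 := bc.ne
    have h7 := cd.ne
    have h8 := da.ne'
    rw [card_insert_of_notMem (by simp [*]), card_insert_of_notMem (by simp [*]),
      card_insert_of_notMem (by simp [*]), card_insert_of_notMem (by simp [*]), card_singleton]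
  have hS : IsDissociationSet G (({v, a, b, c, d} : Finset V) : Set V) := by
    rw [isDissociationSet_iff]
    rw [compl_adj] at va vb vc vd ab bc cd da
    have key : ∀ x ∈ (({v, a, b, c, d} : Finset V) : Set V),
        ∀ y ∈ (({v, a, b, c, d} : Finset V) : Set V), G.Adj x y →
        (x = a ∧ y = c) ∨ (x = c ∧ y = a) ∨ (x = b ∧ y = d) ∨ (x = d ∧ y = b) := by
      intro x hx y hy hxy
      have hyx := hxy.symm
      simp only [coe_insert, coe_singleton, Set.mem_insert_iff, Set.mem_singleton_iff] at hx hy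
      rcases hx with rfl | rfl | rfl | rfl | rfl <;>
        rcases hy with rfl | rfl | rfl | rfl | rfl <;>
        first
          | exact (G.irrefl hxy).elim | exact (va.2 hxy).elim | exact (va.2 hyx).elim
          | exact (vb.2 hxy).elim | exact (vb.2 hyx).elim | exact (vc.2 hxy).elim
          | exact (vc.2 hyx).elim | exact (vd.2 hxy).elim | exact (vd.2 hyx).elim
          | exact (ab.2 hxy).elim | exact (ab.2 hyx).elim | exact (bc.2 hxy).elim
          | exact (bc.2 hyx).elim | exact (cd.2 hxy).elim | exact (cd.2 hyx).elim
          | exact (da.2 hxy).elim | exact (da.2 hyx).elim | exact .inl ⟨rfl, rfl⟩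
          | exact .inr (.inl ⟨rfl, rfl⟩) | exact .inr (.inr (.inl ⟨rfl, rfl⟩))
          | exact .inr (.inr (.inr ⟨rfl, rfl⟩))
    intro p hp x hx y hy px py
    have h1 := key p hp x hx px
    have h2 := key p hp y hy py
    have h5 := ab.1
    have h6 := bc.1
    have h7 := cd.1
    have h8 := da.1
    clear key va vb vc vd ab bc cd da hp hx hy px py hcard h
    grind
  have := le_dissociationNumber hS
  omega

/-- A dissociation set with five vertices contains `p, q` with no edges to its other vertices. Among
three others, some `t` is nonadjacent to the remaining `r, s`. In the complement, `t` is then the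
hub of a wheel with rim `p, r, q, s`. -/
theorem dissociationNumber_le_of_wheelFree_compl [Fintype V] {G : SimpleGraph V}
    (h : WheelFree Gᶜ) : dissociationNumber G ≤ 4 := by
  classical
  refine dissociationNumber_le fun S hS => ?_
  rw [isDissociationSet_iff] at hS
  by_contra hcard
  push Not at hcard
  obtain ⟨p, hp, q, hq, hpq, hp', hq'⟩ : ∃ p ∈ S, ∃ q ∈ S, p ≠ q ∧
      (∀ x ∈ S, x ≠ q → ¬ G.Adj p x) ∧ (∀ x ∈ S, x ≠ p → ¬ G.Adj q x) := by
    by_cases hE : ∃ p ∈ S, ∃ q ∈ S, G.Adj p q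
    · obtain ⟨p, hp, q, hq, hpq⟩ := hE
      exact ⟨p, hp, q, hq, hpq.ne, fun x hx hxq px => hxq (hS p hp x hx q hq px hpq),
        fun x hx hxp qx => hxp (hS q hq x hx p hp qx hpq.symm)⟩
    · push Not at hE
      obtain ⟨p, hp, q, hq, hpq⟩ := one_lt_card.1 (show 1 < #S by omega)
      exact ⟨p, hp, q, hq, hpq, fun x hx _ => hE p hp x hx, fun x hx _ => hE q hq x hx⟩
  have hT : 2 < #((S.erase p).erase q) := by
    rw [card_erase_of_mem (mem_erase.2 ⟨hpq.symm, hq⟩), card_erase_of_mem hp]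
    omega
  have hmem : ∀ {x}, x ∈ (S.erase p).erase q → x ∈ S ∧ Gᶜ.Adj p x ∧ Gᶜ.Adj q x := by
    intro x hx
    rw [mem_erase, mem_erase] at hx
    exact ⟨hx.2.2, ⟨hx.2.1.symm, hp' x hx.2.2 hx.1⟩, ⟨hx.1.symm, hq' x hx.2.2 hx.2.1⟩⟩
  have final : ∀ r s t, r ∈ (S.erase p).erase q → s ∈ (S.erase p).erase q →
      t ∈ (S.erase p).erase q → r ≠ s → r ≠ t → s ≠ t → ¬ G.Adj t r → ¬ G.Adj t s → False := by
    intro r s t hr hs ht rs rt st tr ts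
    have hr' := hmem hr
    have hs' := hmem hs
    have ht' := hmem ht
    exact h ht'.2.1.symm ((compl_adj _ _ _).2 ⟨rt.symm, tr⟩) ht'.2.2.symm
      ((compl_adj _ _ _).2 ⟨st.symm, ts⟩) hr'.2.1 hr'.2.2.symm hs'.2.2 hs'.2.1.symm hpq rs
  obtain ⟨r, hr, s, hs, t, ht, rs, rt, st⟩ := two_lt_card.1 hT
  have hr' := (hmem hr).1
  have hs' := (hmem hs).1
  have ht' := (hmem ht).1
  by_cases h1 : G.Adj t r
  · exact final r t s hr ht hs rt rs st.symm
      (fun h => st (hS r hr' s hs' t ht' h.symm h1.symm))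
      (fun h => rs (hS t ht' r hr' s hs' h1 h.symm))
  by_cases h2 : G.Adj t s
  · exact final s t r hs ht hr st rs.symm rt.symm
      (fun h => rt (hS s hs' r hr' t ht' h.symm h2.symm)) (fun h => h1 h.symm)
  exact final r s t hr hs ht rs rt st h1 h2

end Complement

/-! ### Connected graphs of minimum size and the class `𝓣_{n,4}` -/

section Tree

variable {V : Type*}

/-- The complement of a graph in `matchedPartite V 2` consists of two large parts, nonadjacent
vertices of a part having a common neighbour. -/
theorem exists_parts_of_compl_mem_matchedPartite [Fintype V] (hn : 8 ≤ Fintype.card V)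
    {H : SimpleGraph V} (hH : Hᶜ ∈ matchedPartite V 2) :
    ∃ c : V → Fin 2, (∀ i, 3 ≤ (c ⁻¹' {i}).ncard) ∧ (∀ v w, H.Reachable v w ↔ c v = c w) := by
  obtain ⟨c, M, hc, hM, hHc⟩ := mem_matchedPartite_two.1 hH
  have hsum := ncard_preimage_add c
  have habs := abs_le.1 hc.1
  have hcard : ∀ i, 3 ≤ (c ⁻¹' {i}).ncard := by
    intro i
    fin_cases i
    · simp only [Fin.zero_eta]; omega
    · simp only [Fin.mk_one]; omega
  have hadj : ∀ v w, H.Adj v w ↔ v ≠ w ∧ c v = c w ∧ ¬ (M (c v)).Adj v w := by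
    intro v w
    rw [← compl_compl H, hHc, compl_adj, matchedGraph_adj fun i => (hM i).2.1]
    tauto
  refine ⟨c, hcard, fun v w => ⟨?_, fun h => ?_⟩⟩
  · rintro ⟨p⟩
    induction p with
    | nil => rfl
    | cons h _ ih => exact ((hadj _ _).1 h).2.1.trans ih
  · by_cases hvw : v = w
    · rw [hvw]
    by_cases hMvw : (M (c v)).Adj v w
    · obtain ⟨z, hz, hzvw⟩ := Set.exists_mem_notMem_of_ncard_lt_ncard (s := {v, w})
        (t := c ⁻¹' {c v}) (lt_of_le_of_lt (Set.ncard_pair hvw).le (hcard (c v)))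
      simp only [Set.mem_insert_iff, Set.mem_singleton_iff, not_or, Set.mem_preimage] at hz hzvw
      have hvz : H.Adj v z := (hadj v z).2 ⟨Ne.symm hzvw.1, hz.symm, fun h' =>
        hzvw.2 ((hM (c v)).1.eq_of_adj_left h' hMvw)⟩
      have hwz : H.Adj z w := (hadj z w).2 ⟨hzvw.2, hz.trans h, fun h' => by
        rw [hz] at h'
        exact hzvw.1 ((hM (c v)).1.eq_of_adj_right h' hMvw)⟩
      exact hvz.reachable.trans hwz.reachable
    · exact ((hadj v w).2 ⟨hvw, h, hMvw⟩).reachable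

theorem card_connectedComponent_of_compl_mem_matchedPartite [Fintype V]
    (hn : 8 ≤ Fintype.card V) {H : SimpleGraph V} (hH : Hᶜ ∈ matchedPartite V 2) :
    Nat.card H.ConnectedComponent = 2 := by
  obtain ⟨c, hcard, hreach⟩ := exists_parts_of_compl_mem_matchedPartite hn hH
  have hlift : ∀ (v w : V) (p : H.Walk v w), p.IsPath → c v = c w :=
    fun v w p _ => (hreach v w).1 ⟨p⟩
  rw [Nat.card_eq_of_bijective (ConnectedComponent.lift c hlift), Nat.card_fin]
  constructor
  · intro x y
    induction x using ConnectedComponent.ind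
    induction y using ConnectedComponent.ind
    intro hxy
    exact ConnectedComponent.sound ((hreach _ _).2 hxy)
  · intro i
    obtain ⟨v, hv⟩ := Set.nonempty_of_ncard_ne_zero (s := c ⁻¹' {i}) (by have := hcard i; omega)
    exact ⟨H.connectedComponentMk v, hv⟩

theorem not_connected_of_compl_mem_matchedPartite [Fintype V] (hn : 8 ≤ Fintype.card V)
    {H : SimpleGraph V} (hH : Hᶜ ∈ matchedPartite V 2) : ¬ H.Connected := by
  intro hconn
  have h := card_connectedComponent_of_compl_mem_matchedPartite hn hH
  have := hconn.preconnected.subsingleton_connectedComponent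
  have := Finite.card_le_one_iff_subsingleton.2 this
  omega

theorem ncard_edgeSet_sdiff [Fintype V] {G H : SimpleGraph V} (h : H ≤ G) :
    (G.edgeSet \ H.edgeSet).ncard + size Gᶜ = size Hᶜ := by
  have h1 := size_add_size_compl G
  have h2 := size_add_size_compl H
  have h3 := Set.ncard_sdiff_add_ncard_of_subset (edgeSet_mono h)
  unfold size at *
  omega

/-- Adding an edge to `H` deletes one from `Hᶜ`, so this is the description of `G⁻_{n,4}` read in
the complement. The number of components of `H` is automatically two. -/
theorem mem_treeLike_two_iff [Fintype V] (hn : 8 ≤ Fintype.card V) {G : SimpleGraph V} :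
    G ∈ treeLike V 2 ↔
      G.Connected ∧ WheelFree Gᶜ ∧ size Gᶜ + 1 = wheelBound (Fintype.card V) := by
  constructor
  · rintro ⟨H, hH, -, hHG, hcard, hconn⟩
    have h1 := ncard_edgeSet_sdiff hHG
    rw [hcard, size_of_mem_matchedPartite hH] at h1
    exact ⟨hconn, (wheelFree_of_mem_matchedPartite hH).mono (compl_le_compl hHG), by omega⟩
  · rintro ⟨hconn, hG⟩
    obtain ⟨K, hK, e, he, hGK⟩ := (wheelFree_size_add_one_eq_iff hn).1 hG
    have hK' : Kᶜᶜ ∈ matchedPartite V 2 := by rwa [compl_compl]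
    have hle : Kᶜ ≤ G := by
      rw [compl_le_iff_compl_le, hGK]
      exact deleteEdges_le _
    refine ⟨Kᶜ, hK', card_connectedComponent_of_compl_mem_matchedPartite hn hK', hle, ?_, hconn⟩
    have h1 := ncard_edgeSet_sdiff hle
    rw [size_of_mem_matchedPartite hK'] at h1
    omega

/-- For the lower bound, take two vertices from each part, avoiding one end `x` of the added edge.
The four vertices then span no edges between the parts. -/
theorem dissociationNumber_of_mem_treeLike [Fintype V] (hn : 8 ≤ Fintype.card V)
    {G : SimpleGraph V} (hG : G ∈ treeLike V 2) : dissociationNumber G = 4 := by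
  classical
  refine le_antisymm
    (dissociationNumber_le_of_wheelFree_compl ((mem_treeLike_two_iff hn).1 hG).2.1) ?_
  obtain ⟨H, hH, -, hHG, hcard, hconn⟩ := hG
  obtain ⟨c, hc, hreach⟩ := exists_parts_of_compl_mem_matchedPartite hn hH
  obtain ⟨e, he⟩ := Set.ncard_eq_one.1 hcard
  induction e using Sym2.ind with | _ x y => ?_
  have hpick : ∀ i, ∃ a b, a ≠ b ∧ c a = i ∧ c b = i ∧ a ≠ x ∧ b ≠ x := by
    intro i
    have h1 := Set.ncard_le_ncard_sdiff_add_ncard (c ⁻¹' {i}) {x}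
    rw [Set.ncard_singleton] at h1
    obtain ⟨a, ha, b, hb, hab⟩ := (Set.one_lt_ncard (s := c ⁻¹' {i} \ {x})).1
      (by have := hc i; omega)
    exact ⟨a, b, hab, ha.1, hb.1, ha.2, hb.2⟩
  obtain ⟨a₀, b₀, h0, ha0, hb0, hax0, hbx0⟩ := hpick 0
  obtain ⟨a₁, b₁, h1, ha1, hb1, hax1, hbx1⟩ := hpick 1
  have hne : ∀ u v, c u = 0 → c v = 1 → u ≠ v := by
    rintro u v hu hv rfl
    rw [hu] at hv
    exact absurd hv (by decide)
  have hS : #({a₀, b₀, a₁, b₁} : Finset V) = 4 := by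
    have h2 := hne a₀ a₁ ha0 ha1
    have h3 := hne a₀ b₁ ha0 hb1
    have h4 := hne b₀ a₁ hb0 ha1
    have h5 := hne b₀ b₁ hb0 hb1
    rw [card_insert_of_notMem (by simp [*]), card_insert_of_notMem (by simp [*]),
      card_insert_of_notMem (by simp [*]), card_singleton]
  rw [← hS]
  refine le_dissociationNumber (isDissociationSet_iff.2 ?_)
  have hadj : ∀ u v, u ≠ x → v ≠ x → G.Adj u v → c u = c v := by
    intro u v hu hv huv
    refine (hreach u v).1 (Adj.reachable ?_)
    by_contra hH
    have : s(u, v) ∈ G.edgeSet \ H.edgeSet := ⟨huv, hH⟩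
    rw [he, Set.mem_singleton_iff, Sym2.eq_iff] at this
    tauto
  have hmem : ∀ u ∈ (({a₀, b₀, a₁, b₁} : Finset V) : Set V), u ≠ x ∧
      ((c u = 0 ∧ (u = a₀ ∨ u = b₀)) ∨ (c u = 1 ∧ (u = a₁ ∨ u = b₁))) := by
    intro u hu
    simp only [coe_insert, coe_singleton, Set.mem_insert_iff, Set.mem_singleton_iff] at hu
    rcases hu with rfl | rfl | rfl | rfl <;> simp [*]
  intro v hv p hp q hq vp vq
  have hv' := hmem v hv
  have hp' := hmem p hp
  have hq' := hmem q hq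
  have e1 := hadj v p hv'.1 hp'.1 vp
  have e2 := hadj v q hv'.1 hq'.1 vq
  have n1 := vp.ne
  have n2 := vq.ne
  have h01 : (0 : Fin 2) ≠ 1 := by decide
  clear hmem hadj hne hpick hreach he hc hv hp hq vp vq
  grind

/-- Deleting an edge between the parts of a graph in `G_{n,4}` joins the two components of its
complement. -/
theorem exists_mem_treeLike [Fintype V] (hn : 8 ≤ Fintype.card V) : (treeLike V 2).Nonempty := by
  obtain ⟨K, hK⟩ := matchedPartite_two_nonempty (V := V)
  have hK' : Kᶜᶜ ∈ matchedPartite V 2 := by rwa [compl_compl]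
  obtain ⟨c, hc, hreach⟩ := exists_parts_of_compl_mem_matchedPartite hn hK'
  obtain ⟨a, ha⟩ := Set.nonempty_of_ncard_ne_zero (s := c ⁻¹' {0}) (by have := hc 0; omega)
  obtain ⟨b, hb⟩ := Set.nonempty_of_ncard_ne_zero (s := c ⁻¹' {1}) (by have := hc 1; omega)
  rw [Set.mem_preimage, Set.mem_singleton_iff] at ha hb
  have hab : a ≠ b := by
    rintro rfl
    rw [ha] at hb
    exact absurd hb (by decide)
  have hKab : K.Adj a b := by
    by_contra h
    have := (hreach a b).1 (Adj.reachable ((compl_adj _ _ _).2 ⟨hab, h⟩))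
    rw [ha, hb] at this
    exact absurd this (by decide)
  refine ⟨(K.deleteEdges {s(a, b)})ᶜ, (mem_treeLike_two_iff hn).2 ⟨?_, ?_⟩⟩
  · have hle : Kᶜ ≤ (K.deleteEdges {s(a, b)})ᶜ := compl_le_compl (deleteEdges_le _)
    have hadj : (K.deleteEdges {s(a, b)})ᶜ.Adj a b := by
      simp [compl_adj, hab]
    have hto : ∀ v, (K.deleteEdges {s(a, b)})ᶜ.Reachable a v := by
      intro v
      have hcv : c v = 0 ∨ c v = 1 := by omega
      rcases hcv with hv | hv
      · exact ((hreach a v).2 (ha.trans hv.symm)).mono hle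
      · exact hadj.reachable.trans (((hreach b v).2 (hb.trans hv.symm)).mono hle)
    have : Nonempty V := ⟨a⟩
    exact ⟨fun u v => (hto u).symm.trans (hto v)⟩
  · rw [compl_compl]
    exact (wheelFree_size_add_one_eq_iff hn).2 ⟨K, hK, _, hKab, rfl⟩

theorem size_ge_of_mem_connectedWithDissociationNumber [Fintype V] (hn : 8 ≤ Fintype.card V)
    {G : SimpleGraph V} (hG : G ∈ connectedWithDissociationNumber V 4) :
    (Fintype.card V).choose 2 + 1 ≤ size G + wheelBound (Fintype.card V) := by
  have hW := wheelFree_compl_of_dissociationNumber_le hG.2.le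
  have h1 := size_add_size_compl G
  have h2 := hW.size_le
  -- Equality would put `Gᶜ` in `G_{n,4}` and make `G` disconnected. This is where the extra edge
  -- comes from.
  have h3 : size Gᶜ ≠ wheelBound (Fintype.card V) := fun h =>
    not_connected_of_compl_mem_matchedPartite hn ((wheelFree_size_eq_iff hn).1 ⟨hW, h⟩) hG.1
  omega

theorem eMin_add_wheelBound {n : ℕ} (hn : 8 ≤ n) :
    eMin n 4 + wheelBound n = n.choose 2 + 1 := by
  have hn' : 8 ≤ Fintype.card (Fin n) := by rwa [Fintype.card_fin]
  obtain ⟨T, hT⟩ := exists_mem_treeLike (V := Fin n) hn'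
  have hT' := (mem_treeLike_two_iff hn').1 hT
  have hTD : T ∈ connectedWithDissociationNumber (Fin n) 4 :=
    ⟨hT'.1, dissociationNumber_of_mem_treeLike hn' hT⟩
  have h1 : eMin n 4 ≤ size T := Nat.sInf_le ⟨T, hTD, rfl⟩
  -- Since `T` lies in the class, the infimum is attained and is not the default value `0` of the
  -- empty set.
  obtain ⟨G, hG, hGs⟩ : eMin n 4 ∈ size '' connectedWithDissociationNumber (Fin n) 4 :=
    Nat.sInf_mem ⟨_, T, hTD, rfl⟩
  have h2 := size_ge_of_mem_connectedWithDissociationNumber hn' hG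
  have h3 := size_add_size_compl T
  have h4 := hT'.2.2
  rw [Fintype.card_fin] at h2 h3 h4
  omega

end Tree

end DissociationGraphs

theorem mainTheorem3 {V : Type*} [Fintype V] (hn : 8 ≤ Fintype.card V) (G : SimpleGraph V) :
    ((G ∈ DissociationGraphs.connectedWithDissociationNumber V 4 ∧
        DissociationGraphs.size G = DissociationGraphs.eMin (Fintype.card V) 4) ↔
      G ∈ DissociationGraphs.treeLike V 2) ∧
    (((DissociationGraphs.oddCocktailParty 2).Free G ∧
        DissociationGraphs.size G =
          SimpleGraph.extremalNumber (Fintype.card V) (DissociationGraphs.oddCocktailParty 2)) ↔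
      G ∈ DissociationGraphs.matchedPartite V 2) ∧
    (((DissociationGraphs.oddCocktailParty 2).Free G ∧
        DissociationGraphs.size G + 1 =
          SimpleGraph.extremalNumber (Fintype.card V) (DissociationGraphs.oddCocktailParty 2)) ↔
      G ∈ DissociationGraphs.matchedPartiteMinus V 2) := by
  open DissociationGraphs in
  rw [extremalNumber_eq_wheelBound, oddCocktailParty_two_free_iff]
  refine ⟨?_, wheelFree_size_eq_iff hn, wheelFree_size_add_one_eq_iff hn⟩
  have h1 := eMin_add_wheelBound hn
  have h2 := size_add_size_compl G
  constructor
  · rintro ⟨hG, hs⟩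
    exact (mem_treeLike_two_iff hn).2
      ⟨hG.1, wheelFree_compl_of_dissociationNumber_le hG.2.le, by omega⟩
  · intro hG
    have h3 := (mem_treeLike_two_iff hn).1 hG
    exact ⟨⟨h3.1, dissociationNumber_of_mem_treeLike hn hG⟩, by omega⟩
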